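/- Let $\mathbb{Y},\mathbb{E}$ be finite-dimensional Euclidean spaces. For $\Omega\subset\mathbb{Y}$ and $x\in\Omega$ let $T_\Omega(x)$ be the Bouligand tangent cone, $\widehat N_\Omega(x)=\{v:\limsup_{x'\to x,\,x'\in\Omega}\langle v,x'-x\rangle/\|x'-x\|\le 0\}$ the regular normal cone, and $N_\Omega(x)$ the limiting normal cone, i.e. the set of limits $v=\lim v_k$ with $v_k\in\widehat N_\Omega(x_k)$, $x_k\to x$; these sets are empty if $x\notin\Omega$. The graphical derivative of a set-valued map $F$ at $(x,y)\in\mathrm{gph}\,F$ is $DF(x,y)(u)=\{v:(u,v)\in T_{\mathrm{gph}\,F}(x,y)\}$, and $K_\Theta(z,\lambda)=T_\Theta(z)\cap\{\lambda\}^\perp$ is the critical cone. A closed set $\Theta\subset\mathbb{Y}$ is $\mathcal{C}^2$-cone reducible at $\bar z\in\Theta$ to a closed convex cone $C\subset\mathbb{E}$ via $h$ if, for some open neighborhood $\mathcal{O}$ of $\bar z$, $h$ is $\mathcal{C}^2$ on $\mathcal{O}$, $\Theta\cap\mathcal{O}=\{z\in\mathcal{O}: h(z)\in C\}$, $h(\bar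 z)=0$, and $\nabla h(\bar z)$ is surjective. **General formula.** Let $\bar\lambda\in N_\Theta(\bar z)$ and let $\Theta$ be $\mathcal{C}^2$-cone reducible at $\bar z$ to $C$ via $h$. Then the system $\bar\lambda=\nabla h(\bar z)^*\bar\mu$, $\bar\mu\in N_C(h(\bar z))$ has a unique solution $\bar\mu$, and $$DN_\Theta(\bar z,\bar\lambda)(u)=\nabla^2\langle\bar\mu,h\rangle(\bar z)u+N_{K_\Theta(\bar z,\bar\lambda)}(u)\quad\text{for all }u\in\mathbb{Y}.$$ **Curvature term.** In each of the following cases the stated $h$ reduces $\Theta$ at $\bar z\in\Theta$ to the stated $C$ in the above sense, and for every $\bar\lambda\in N_\Theta(\bar z)$, with $\bar\mu$ the corresponding solution, the curvature term is as follows. (a) $\Theta\subset\mathbb{R}^m$ is a convex polyhedron. Let $A:\mathbb{R}^s\times\mathbb{R}^{m-s}\to\mathbb{R}^m$ be a linear isometry with $A^{-1}(\mathrm{span}\,N_\Theta(\bar z))=\mathbb{R}^s\times\{0\}$, let $B$ be the first ($\mathbb{R}^s$-)component of $A^{-1}$, $A^{-1}\bar z=(B\bar z,\bar y)$, $h(z)=Bz-B\bar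 z$, and $C=T_D(B\bar z)$ with $D=\{x\in\mathbb{R}^s:A(x,\bar y)\in\Theta\}$. Then $\nabla^2\langle\bar\mu,h\rangle(\bar z)u=0$ for all $u\in\mathbb{R}^m$. (b) $\Theta=\mathcal{Q}=\{(s_r,s_m)\in\mathbb{R}^{m-1}\times\mathbb{R}:\|s_r\|\le s_m\}$, $m\ge1$, with $h(z)=z$, $C=\mathcal{Q}$ if $\bar z=0$; $h=0$ with values in $C=\mathbb{E}=\{0\}$ if $\bar z\in\mathrm{int}\,\mathcal{Q}$; and $h(z)=\|z_r\|^2-z_m^2$, $C=\mathbb{R}_-$ if $\bar z\in\mathrm{bd}\,\mathcal{Q}\setminus\{0\}$. Then $\nabla^2\langle\bar\mu,h\rangle(\bar z)u=\mathcal{H}(\bar z,\bar\lambda)u$ for all $u\in\mathbb{R}^m$, where $\mathcal{H}(\bar z,\bar\lambda)=-\frac{\bar\lambda_m}{\bar z_m}\mathrm{diag}(1,\dots,1,-1)$ if $\bar z\in\mathrm{bd}\,\mathcal{Q}\setminus\{0\}$, and $\mathcal{H}(\bar z,\bar\lambda)=0$ otherwise. (c) $\Theta=\mathcal{S}^m_+$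 in the space $\mathcal{S}^m$ of symmetric $m\times m$ matrices with inner product $\mathrm{tr}(AB)$. Let $k=m-\mathrm{rank}\,\bar z$, let $e_1,\dots,e_k$ be an orthonormal basis of $\ker\bar z$, let $P(B)$ be the orthogonal projection onto the sum of the eigenspaces of $B$ for its $k$ smallest eigenvalues, let $U(B)$ be the $m\times k$ matrix whose columns are obtained from $P(B)e_1,\dots,P(B)e_k$ by Gram–Schmidt orthonormalization, $h(B)=U(B)^*BU(B)\in\mathcal{S}^k$, and $C=\mathcal{S}^k_+$ (all this for $B$ near $\bar z$; for $k=0$ these are zero spaces). Then, with $\bar z^\dagger$ the Moore–Penrose pseudo-inverse, $$\nabla^2\langle\bar\mu,h\rangle(\bar z)u=-\bar\lambda u\bar z^\dagger-\bar z^\dagger u\bar\lambda\quad\text{for all }u\in\mathcal{S}^m;$$ equivalently, $\nabla^2\langle\bar\mu,h\rangle(\bar z)u$ acts as $-2\bar\lambda u\bar z^\dagger$ on $\mathcal{S}^m$: $\langle\nabla^2\langle\bar\mu,h\rangle(\bar z)u,w\rangle=\mathrm{tr}(-2\bar\lambda u\bar z^\dagger w)$ for all $u,w\in\mathcal{S}^m$.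 -/

import Mathlib

open Filter Topology Set
open scoped InnerProductSpace

namespace VarAnal

noncomputable section

/-! ### Tangent cones, normal cones, graphical derivatives -/

section Cones

/-- The Bouligand–Severi tangent cone `T_Ω(x)`: all `w` for which there are `t k ↓ 0` and `w k → w`
with `x + t k • w k ∈ Ω`. It is empty when `x ∉ Ω`. -/
def tangentCone {X : Type*} [NormedAddCommGroup X] [NormedSpace ℝ X] (Ω : Set X) (x : X) : Set X :=
  {w | x ∈ Ω ∧ ∃ (t : ℕ → ℝ) (wk : ℕ → X), (∀ k, 0 < t k) ∧ Tendsto t atTop (𝓝 0) ∧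
    Tendsto wk atTop (𝓝 w) ∧ ∀ k, x + t k • wk k ∈ Ω}

variable {X : Type*} [NormedAddCommGroup X] [InnerProductSpace ℝ X]

/-- The regular (Fréchet) normal cone: `limsup ⟪v, x' - x⟫ / ‖x' - x‖ ≤ 0` as `x' → x` in `Ω`.
It is empty when `x ∉ Ω`. -/
def regularNormalCone (Ω : Set X) (x : X) : Set X :=
  {v | x ∈ Ω ∧ ∀ ε : ℝ, 0 < ε → ∀ᶠ x' in 𝓝[Ω] x, ⟪v, x' - x⟫_ℝ ≤ ε * ‖x' - x‖}

/-- The limiting (Mordukhovich) normal cone `N_Ω(x)`. It is empty when `x ∉ Ω`. -/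
def normalCone (Ω : Set X) (x : X) : Set X :=
  {v | x ∈ Ω ∧ ∃ (xk vk : ℕ → X), Tendsto xk atTop (𝓝 x) ∧ Tendsto vk atTop (𝓝 v) ∧
    ∀ k, vk k ∈ regularNormalCone Ω (xk k)}

/-- The critical cone `K_Ω(z, l) = T_Ω(z) ∩ {l}^⊥`. -/
def criticalCone (Ω : Set X) (z l : X) : Set X :=
  {w | w ∈ tangentCone Ω z ∧ ⟪l, w⟫_ℝ = 0}

end Cones

/-- The graph of a set-valued mapping. -/
def setValuedGraph {X Y : Type*} (F : X → Set Y) : Set (X × Y) := {p | p.2 ∈ F p.1}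

/-- The graphical derivative: `v ∈ DF(x, y)(u)` iff `(u, v)` is tangent to `gph F` at `(x, y)`. -/
def graphicalDerivative {X Y : Type*} [NormedAddCommGroup X] [NormedSpace ℝ X]
    [NormedAddCommGroup Y] [NormedSpace ℝ Y] (F : X → Set Y) (x : X) (y : Y) (u : X) : Set Y :=
  {v | (u, v) ∈ tangentCone (setValuedGraph F) (x, y)}

/-! ### Reducible sets, reduced multipliers, the curvature term -/

/-- A closed convex cone (it then contains `0`). -/
structure IsClosedConvexCone {E : Type*} [NormedAddCommGroup E] [NormedSpace ℝ E] (C : Set E) :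
    Prop where
  isClosed : IsClosed C
  convex : Convex ℝ C
  nonempty : C.Nonempty
  smul_mem : ∀ t : ℝ, 0 ≤ t → ∀ x ∈ C, t • x ∈ C

/-- The set `Θ` is `C²`-cone reducible at `z` to the closed convex cone `C` via the mapping `h`. -/
structure IsConeReduction {Y E : Type*} [NormedAddCommGroup Y] [NormedSpace ℝ Y]
    [NormedAddCommGroup E] [NormedSpace ℝ E] (Θ : Set Y) (z : Y) (C : Set E) (h : Y → E) :
    Prop where
  isClosed : IsClosed Θ
  mem : z ∈ Θ
  cone : IsClosedConvexCone C
  reduces : ∃ O : Set Y, IsOpen O ∧ z ∈ O ∧ ContDiffOn ℝ 2 h O ∧ Θ ∩ O = {y | y ∈ O ∧ h y ∈ C}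
  map_eq_zero : h z = 0
  surjective : Function.Surjective (fderiv ℝ h z)

section Curvature

variable {Y E : Type*} [NormedAddCommGroup Y] [InnerProductSpace ℝ Y] [FiniteDimensional ℝ Y]
  [NormedAddCommGroup E] [InnerProductSpace ℝ E] [FiniteDimensional ℝ E]

/-- `μ` solves the system `l = ∇h(z)^* μ`, `μ ∈ N_C(h(z))`. -/
def IsReducedMultiplier (C : Set E) (h : Y → E) (z l : Y) (μ : E) : Prop :=
  l = LinearMap.adjoint (fderiv ℝ h z : Y →ₗ[ℝ] E) μ ∧ μ ∈ normalCone C (h z)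

/-- The Hessian `∇²g(z) u` of a scalar function: the derivative of its gradient. -/
def hessian (g : Y → ℝ) (z u : Y) : Y :=
  haveI : CompleteSpace Y := FiniteDimensional.complete ℝ Y
  fderiv ℝ (gradient g) z u

/-- The curvature term `∇²⟨μ, h⟩(z) u`. -/
def curvature (h : Y → E) (μ : E) (z u : Y) : Y :=
  hessian (fun y => ⟪μ, h y⟫_ℝ) z u

end Curvature

/-! ### Convex polyhedra -/

/-- A convex polyhedron: the solution set of finitely many linear inequalities. -/
def IsConvexPolyhedron {Y : Type*} [NormedAddCommGroup Y] [InnerProductSpace ℝ Y] (Θ : Set Y) :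
    Prop :=
  ∃ (k : ℕ) (a : Fin k → Y) (b : Fin k → ℝ), Θ = {z | ∀ i, ⟪a i, z⟫_ℝ ≤ b i}

section Polyhedron

variable {m s t : ℕ}

/-- The affine reduction map `h(y) = B y - B z`, where `B` consists of the first `s` rows of
`A⁻¹`. -/
def polyReduction
    (A : WithLp 2 (EuclideanSpace ℝ (Fin s) × EuclideanSpace ℝ (Fin t)) ≃ₗᵢ[ℝ]
      EuclideanSpace ℝ (Fin m))
    (z y : EuclideanSpace ℝ (Fin m)) : EuclideanSpace ℝ (Fin s) :=
  (A.symm y).fst - (A.symm z).fst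

/-- The cone `T_D(B z)` with `D = {x | A (x, z') ∈ Θ}`, where `A⁻¹ z = (B z, z')`. -/
def polyCone (Θ : Set (EuclideanSpace ℝ (Fin m)))
    (A : WithLp 2 (EuclideanSpace ℝ (Fin s) × EuclideanSpace ℝ (Fin t)) ≃ₗᵢ[ℝ]
      EuclideanSpace ℝ (Fin m))
    (z : EuclideanSpace ℝ (Fin m)) : Set (EuclideanSpace ℝ (Fin s)) :=
  tangentCone {x | A (WithLp.toLp 2 (x, (A.symm z).snd)) ∈ Θ} (A.symm z).fst

end Polyhedron

/-! ### The second-order cone -/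

/-- `ℝ^(n+1) = ℝⁿ × ℝ` with its Euclidean structure; `z.fst` is `z_r` and `z.snd` the last
coordinate. -/
abbrev LorentzSpace (n : ℕ) : Type := WithLp 2 (EuclideanSpace ℝ (Fin n) × ℝ)

/-- The second-order (Lorentz, ice-cream) cone. -/
def secondOrderCone (n : ℕ) : Set (LorentzSpace n) := {z | ‖z.fst‖ ≤ z.snd}

/-- The reduction map `‖z_r‖² - z_m²` at nonzero boundary points. -/
def socReduction {n : ℕ} (z : LorentzSpace n) : ℝ := ‖z.fst‖ ^ 2 - z.snd ^ 2

open Classical in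
/-- `𝓗(z, l) u`: equal to `-(l_m / z_m) diag(1, …, 1, -1) u` if `z` is a nonzero boundary point of
the cone, and to `0` otherwise. -/
def socCurvature {n : ℕ} (z l u : LorentzSpace n) : LorentzSpace n :=
  if z ∈ frontier (secondOrderCone n) ∧ z ≠ 0 then
    (-(l.snd / z.snd)) • WithLp.toLp 2 (u.fst, -u.snd)
  else 0

/-! ### Symmetric matrices and the positive semidefinite cone -/

/-- Symmetric matrices inside all `m × m` matrices, the latter with the Frobenius structure. -/
def symmetricSubmodule (m : ℕ) : Submodule ℝ (EuclideanSpace ℝ (Fin m × Fin m)) where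
  carrier := {A | ∀ i j, A (i, j) = A (j, i)}
  add_mem' := by
    intro A B hA hB i j
    simp [hA i j, hB i j]
  zero_mem' := by
    intro i j
    simp
  smul_mem' := by
    intro c A hA i j
    simp [hA i j]

/-- The Euclidean space `𝓢^m` of symmetric `m × m` matrices, with inner product `tr (A B)`
(see `SymMat.inner_eq_trace`) and hence with the Frobenius norm. -/
abbrev SymMat (m : ℕ) : Type := symmetricSubmodule m

/-- The underlying matrix. -/
def SymMat.toMatrix {m : ℕ} (A : SymMat m) : Matrix (Fin m) (Fin m) ℝ :=
  Matrix.of fun i j => A.1 (i, j)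

theorem SymMat.isSymm {m : ℕ} (A : SymMat m) : A.toMatrix.IsSymm := by
  ext i j
  exact A.2 j i

/-- A symmetric matrix as an element of `𝓢^m`. -/
def SymMat.ofMatrix {m : ℕ} (M : Matrix (Fin m) (Fin m) ℝ) (hM : M.IsSymm) : SymMat m :=
  ⟨WithLp.toLp 2 fun p => M p.1 p.2, fun i j => hM.apply j i⟩

theorem SymMat.toMatrix_ofMatrix {m : ℕ} (M : Matrix (Fin m) (Fin m) ℝ) (hM : M.IsSymm) :
    (SymMat.ofMatrix M hM).toMatrix = M := rfl

theorem SymMat.inner_eq_trace {m : ℕ} (A B : SymMat m) :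
    ⟪A, B⟫_ℝ = (A.toMatrix * B.toMatrix).trace := by
  rw [Submodule.coe_inner, PiLp.inner_apply, Fintype.sum_prod_type]
  simp only [Matrix.trace, Matrix.diag, Matrix.mul_apply]
  refine Finset.sum_congr rfl fun i _ => Finset.sum_congr rfl fun j _ => ?_
  have h : (B : EuclideanSpace ℝ (Fin m × Fin m)) (i, j) = B.1 (j, i) := B.2 i j
  simp [SymMat.toMatrix, h, mul_comm]

/-- The cone of positive semidefinite symmetric matrices. -/
def psdCone (m : ℕ) : Set (SymMat m) := {A | A.toMatrix.PosSemidef}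

/-- `X` is the Moore–Penrose pseudo-inverse of the real matrix `A` (the four Penrose equations). -/
def IsMoorePenrose {m : ℕ} (A X : Matrix (Fin m) (Fin m) ℝ) : Prop :=
  A * X * A = A ∧ X * A * X = X ∧ (A * X).IsSymm ∧ (X * A).IsSymm

/-- The Moore–Penrose pseudo-inverse `A†`. -/
def pinv {m : ℕ} (A : Matrix (Fin m) (Fin m) ℝ) : Matrix (Fin m) (Fin m) ℝ :=
  Classical.epsilon (IsMoorePenrose A)

theorem IsMoorePenrose.unique {m : ℕ} {A X Z : Matrix (Fin m) (Fin m) ℝ}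
    (hX : IsMoorePenrose A X) (hZ : IsMoorePenrose A Z) : X = Z := by
  obtain ⟨x1, x2, x3, x4⟩ := hX
  obtain ⟨z1, z2, z3, z4⟩ := hZ
  have e1 : A * X = A * Z := by
    calc A * X = (A * X).transpose := x3.symm
      _ = ((A * Z) * (A * X)).transpose := by rw [← mul_assoc, z1]
      _ = (A * X) * (A * Z) := by rw [Matrix.transpose_mul, x3, z3]
      _ = A * Z := by rw [← mul_assoc, x1]
  have e2 : X * A = Z * A := by
    calc X * A = (X * A).transpose := x4.symm
      _ = ((X * A) * (Z * A)).transpose := by rw [mul_assoc, ← mul_assoc A, z1]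
      _ = (Z * A) * (X * A) := by rw [Matrix.transpose_mul, x4, z4]
      _ = Z * A := by rw [mul_assoc, ← mul_assoc A, x1]
  calc X = X * A * X := x2.symm
    _ = Z * A * X := by rw [e2]
    _ = Z * (A * Z) := by rw [mul_assoc, e1]
    _ = Z := by rw [← mul_assoc, z2]

theorem isMoorePenrose_pinv {m : ℕ} {A : Matrix (Fin m) (Fin m) ℝ} (hA : A.IsSymm) :
    IsMoorePenrose A (pinv A) := by
  have hH : A.IsHermitian := by
    rw [Matrix.IsHermitian, Matrix.conjTranspose_eq_transpose_of_trivial]; exact hA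
  have key : ∃ X, IsMoorePenrose A X := by
    obtain ⟨U, d, hUU, spec⟩ : ∃ (U : Matrix (Fin m) (Fin m) ℝ) (d : Fin m → ℝ),
        U.transpose * U = 1 ∧ A = U * Matrix.diagonal d * U.transpose := by
      refine ⟨hH.eigenvectorUnitary, hH.eigenvalues, ?_, ?_⟩
      · rw [← Matrix.conjTranspose_eq_transpose_of_trivial, ← Matrix.star_eq_conjTranspose]
        simp
      · have := hH.spectral_theorem
        rw [Unitary.conjStarAlgAut_apply] at this
        rw [← Matrix.conjTranspose_eq_transpose_of_trivial, ← Matrix.star_eq_conjTranspose]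
        exact this
    have conj : ∀ M N : Matrix (Fin m) (Fin m) ℝ,
        (U * M * U.transpose) * (U * N * U.transpose) = U * (M * N) * U.transpose := by
      intro M N
      calc (U * M * U.transpose) * (U * N * U.transpose)
          = U * M * (U.transpose * U) * N * U.transpose := by simp only [mul_assoc]
        _ = _ := by rw [hUU, mul_one, mul_assoc U M N]
    have symm : ∀ d : Fin m → ℝ, (U * Matrix.diagonal d * U.transpose).IsSymm := by
      intro d
      simp [Matrix.IsSymm, Matrix.transpose_mul, mul_assoc]
    refine ⟨U * Matrix.diagonal (fun i => (d i)⁻¹) * U.transpose, ?_⟩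
    subst spec
    clear hA hH
    refine ⟨?_, ?_, ?_, ?_⟩
    · rw [conj, conj, Matrix.diagonal_mul_diagonal, Matrix.diagonal_mul_diagonal]
      congr 3; funext i; exact mul_inv_mul_cancel (d i)
    · rw [conj, conj, Matrix.diagonal_mul_diagonal, Matrix.diagonal_mul_diagonal]
      congr 3; funext i; simpa using mul_inv_mul_cancel (d i)⁻¹
    · rw [conj, Matrix.diagonal_mul_diagonal]; exact symm _
    · rw [conj, Matrix.diagonal_mul_diagonal]; exact symm _
  exact Classical.epsilon_spec key

section PSD

variable {m k : ℕ}

/-- The sum of the eigenspaces of `B` for its `k` smallest eigenvalues: the eigenvalue `ν` is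
included iff fewer than `k` eigenvalues, counted with multiplicity, are strictly smaller. -/
def lowEigenspace (k : ℕ) (B : Matrix (Fin m) (Fin m) ℝ) :
    Submodule ℝ (EuclideanSpace ℝ (Fin m)) :=
  ⨆ (ν : ℝ) (_ : Module.finrank ℝ
      (⨆ (ν' : ℝ) (_ : ν' < ν), Module.End.eigenspace (Matrix.toEuclideanLin B) ν' :
        Submodule ℝ (EuclideanSpace ℝ (Fin m))) < k),
    Module.End.eigenspace (Matrix.toEuclideanLin B) ν

/-- The `m × k` matrix `U(B)` obtained by Gram–Schmidt orthonormalization of the vectors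
`P(B) e_1, …, P(B) e_k`, where `P(B)` is the orthogonal projection onto `lowEigenspace k B`. -/
def lowFrame (e : Fin k → EuclideanSpace ℝ (Fin m)) (B : Matrix (Fin m) (Fin m) ℝ) :
    Matrix (Fin m) (Fin k) ℝ :=
  Matrix.of fun i j =>
    InnerProductSpace.gramSchmidtNormed ℝ (fun l => (lowEigenspace k B).starProjection (e l)) j i

/-- The reduction map `h(B) = U(B)^* B U(B)` from `𝓢^m` to `𝓢^k`. -/
def psdReduction (e : Fin k → EuclideanSpace ℝ (Fin m)) (B : SymMat m) : SymMat k :=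
  SymMat.ofMatrix
    ((lowFrame e B.toMatrix).transpose * B.toMatrix * lowFrame e B.toMatrix) (by
      rw [Matrix.IsSymm, Matrix.transpose_mul, Matrix.transpose_mul, Matrix.transpose_transpose,
        B.isSymm, Matrix.mul_assoc])

end PSD

end

end VarAnal

open VarAnal

/-!
**The general formula.** Near `z` the mapping `h` is a submersion, so it has differentiable right
inverses (`exists_rightInverse_family`), and regular normals pull back along differentiable maps
(`adjoint_mem_regularNormalCone`). Hence `N_Θ(y) = ∇h(y)^* N_C(h(y))` for `y` near `z`
(`mem_normalCone_preimage_iff`), with a multiplier that is unique because `∇h(y)^*` is injective.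
Difference quotients of `N_Θ` at `(z, l)` along `u` therefore split into those of
`y ↦ ∇h(y)^* μ`, which converge to the curvature term `∇²⟨μ, h⟩(z) u`, and the images under
`∇h(y)^*` of difference quotients of `N_C` at `(0, μ)`; left inverses of `∇h(y)^*` that are
continuous in `y` make the latter converge. For a closed convex cone `C` the limits of these are
exactly the normals of the critical cone `C ∩ {μ}^⊥`: one inclusion is a passage to the limit
in the complementarity conditions (`IsClosedConvexCone.mem_normalCone_critical`), the other projects
`μ + t (a + b)` onto `C`
(`IsClosedConvexCone.exists_tendsto_of_mem_normalCone_critical`). Pulled back by `∇h(z)`, they are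
the normals of the critical cone of `Θ` (`IsConeReduction.mem_normalCone_criticalCone_iff`).

**Polyhedra and the second-order cone.** Near `z` a polyhedron is cut out by its active
inequalities. Their normals lie in `N_Θ(z)`, so they depend on the first block of coordinates only,
and the reduction map, being affine, has no curvature. For the second-order cone the Hessian of
`‖z_r‖² - z_m²` is `2 diag(1, …, 1, -1)`, and `l = ∇h(z)^* μ` gives `l_m = -2 μ z_m`.

**The positive semidefinite cone.** Zero is an isolated part of the spectrum of `z`. The implicit
function theorem, applied to the Riccati equation for the graph of an operator from `ker z` to its
complement, extends `ker z` to a smooth family of invariant subspaces (`exists_smooth_riccati`).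
The numerical ranges of `B` on such a subspace and on its orthogonal complement are separated, so
it is the sum of the eigenspaces for the `k` smallest eigenvalues (`iSup_lowest_eigenspaces_eq`), and
Gram–Schmidt keeps smoothness. So `U(B)` is smooth, `B U = U h(B)`, and semidefiniteness of `B` is
that of `h(B)`. For the curvature, orthonormality of `U` makes `U(z)^* U'(z)` antisymmetric and
Gram–Schmidt makes it triangular, so it vanishes; differentiating `B U = U h(B)` then gives
`U'(z) u = -z† u U(z)` (`fderiv_lowVectors`). In the derivative of `B ↦ ∇h(B) w` only the terms
`(U' u)^* w U + U^* w (U' u)` survive, since the others are products of two factors vanishing at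
`z`; pairing with `μ`, where `l = U(z) μ U(z)^*`, yields `-l u z† - z† u l`.
-/

namespace VarAnal

/-! ### Normal cones of convex sets and of closed convex cones -/

section ConvexNormals

variable {X : Type*} [NormedAddCommGroup X] [InnerProductSpace ℝ X] {C : Set X} {x v : X}

theorem mem_regularNormalCone_iff_of_convex (hC : Convex ℝ C) :
    v ∈ regularNormalCone C x ↔ x ∈ C ∧ ∀ y ∈ C, ⟪v, y - x⟫_ℝ ≤ 0 := by
  constructor
  · rintro ⟨hx, hv⟩
    refine ⟨hx, fun y hy => le_of_forall_pos_le_add fun δ hδ => ?_⟩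
    have hn : 0 < ‖y - x‖ + 1 := by positivity
    have hlim : Tendsto (fun t : ℝ => x + t • (y - x)) (𝓝[>] 0) (𝓝[C] x) := by
      refine tendsto_nhdsWithin_iff.2 ⟨?_, ?_⟩
      · have : Continuous fun t : ℝ => x + t • (y - x) := by fun_prop
        have := this.tendsto 0
        simp only [zero_smul, add_zero] at this
        exact this.mono_left nhdsWithin_le_nhds
      · filter_upwards [Ioc_mem_nhdsGT (zero_lt_one (α := ℝ))] with t ht
        exact hC.add_smul_sub_mem hx hy ⟨ht.1.le, ht.2⟩
    obtain ⟨t, ht, ht0⟩ := ((hlim.eventually (hv (δ / (‖y - x‖ + 1)) (by positivity))).and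
      self_mem_nhdsWithin).exists
    have ht0 : 0 < t := ht0
    rw [add_sub_cancel_left, inner_smul_right, norm_smul, Real.norm_of_nonneg ht0.le,
      mul_left_comm] at ht
    have h1 := le_of_mul_le_mul_left ht ht0
    refine h1.trans ?_
    rw [zero_add, div_mul_eq_mul_div, div_le_iff₀ hn]
    nlinarith
  · rintro ⟨hx, hv⟩
    refine ⟨hx, fun ε hε => ?_⟩
    filter_upwards [self_mem_nhdsWithin] with y hy
    exact (hv y hy).trans (by positivity)

theorem regularNormalCone_subset_normalCone (Ω : Set X) (x : X) :
    regularNormalCone Ω x ⊆ normalCone Ω x := fun v hv =>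
  ⟨hv.1, fun _ => x, fun _ => v, tendsto_const_nhds, tendsto_const_nhds, fun _ => hv⟩

theorem mem_normalCone_iff_of_convex (hC : Convex ℝ C) :
    v ∈ normalCone C x ↔ x ∈ C ∧ ∀ y ∈ C, ⟪v, y - x⟫_ℝ ≤ 0 := by
  constructor
  · rintro ⟨hx, xk, vk, hxk, hvk, h⟩
    refine ⟨hx, fun y hy => ?_⟩
    refine le_of_tendsto (hvk.inner (tendsto_const_nhds.sub hxk)) (Eventually.of_forall fun k => ?_)
    exact ((mem_regularNormalCone_iff_of_convex hC).1 (h k)).2 y hy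
  · intro h
    exact regularNormalCone_subset_normalCone C x ((mem_regularNormalCone_iff_of_convex hC).2 h)

theorem normalCone_eq_regularNormalCone_of_convex (hC : Convex ℝ C) :
    normalCone C x = regularNormalCone C x := by
  ext v
  rw [mem_normalCone_iff_of_convex hC, mem_regularNormalCone_iff_of_convex hC]

theorem IsClosedConvexCone.zero_mem (hC : IsClosedConvexCone C) : (0 : X) ∈ C := by
  obtain ⟨x, hx⟩ := hC.nonempty
  simpa using hC.smul_mem 0 le_rfl x hx

theorem IsClosedConvexCone.smul_mem_iff (hC : IsClosedConvexCone C) {t : ℝ} (ht : 0 < t) :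
    t • x ∈ C ↔ x ∈ C := by
  refine ⟨fun h => ?_, hC.smul_mem t ht.le x⟩
  simpa [smul_smul, inv_mul_cancel₀ ht.ne'] using hC.smul_mem t⁻¹ (inv_nonneg.2 ht.le) _ h

/-- Normals to a closed convex cone are complementary: `x ∈ C`, `v ∈ C°`, `v ⊥ x`. -/
theorem IsClosedConvexCone.mem_normalCone_iff (hC : IsClosedConvexCone C) :
    v ∈ normalCone C x ↔ x ∈ C ∧ ⟪v, x⟫_ℝ = 0 ∧ ∀ y ∈ C, ⟪v, y⟫_ℝ ≤ 0 := by
  rw [mem_normalCone_iff_of_convex hC.convex]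
  refine and_congr_right fun hx => ⟨fun h => ?_, fun ⟨h1, h2⟩ y hy => ?_⟩
  · have h0 : ⟪v, x⟫_ℝ = 0 := by
      have h1 := h 0 hC.zero_mem
      have h2 := h ((2 : ℝ) • x) (hC.smul_mem 2 (by norm_num) x hx)
      rw [zero_sub, inner_neg_right] at h1
      rw [two_smul, add_sub_cancel_right] at h2
      linarith
    refine ⟨h0, fun y hy => ?_⟩
    have := h y hy
    rwa [inner_sub_right, h0, sub_zero] at this
  · rw [inner_sub_right, h1, sub_zero]
    exact h2 y hy

/-- The critical cone of a closed convex cone at its apex is again a closed convex cone. -/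
theorem IsClosedConvexCone.inter_orthogonal (hC : IsClosedConvexCone C) (μ : X) :
    IsClosedConvexCone {x | x ∈ C ∧ ⟪μ, x⟫_ℝ = 0} where
  isClosed := hC.isClosed.inter (isClosed_eq (by fun_prop) continuous_const)
  convex := by
    refine hC.convex.inter ?_
    intro x hx y hy a b _ _ _
    have hx : ⟪μ, x⟫_ℝ = 0 := hx
    have hy : ⟪μ, y⟫_ℝ = 0 := hy
    show ⟪μ, a • x + b • y⟫_ℝ = 0
    simp [inner_add_right, inner_smul_right, hx, hy]
  nonempty := ⟨0, hC.zero_mem, inner_zero_right _⟩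
  smul_mem t ht x hx := ⟨hC.smul_mem t ht x hx.1, by rw [inner_smul_right, hx.2, mul_zero]⟩

end ConvexNormals

section Tangents

variable {X : Type*} [NormedAddCommGroup X] [NormedSpace ℝ X]

/-- For a tangent vector it suffices that the defining sequences behave eventually. -/
theorem mem_tangentCone_of_eventually {Ω : Set X} {x w : X} (hx : x ∈ Ω) {t : ℕ → ℝ}
    {wk : ℕ → X} (ht : ∀ k, 0 < t k) (ht0 : Tendsto t atTop (𝓝 0))
    (hw : Tendsto wk atTop (𝓝 w)) (h : ∀ᶠ k in atTop, x + t k • wk k ∈ Ω) :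
    w ∈ tangentCone Ω x := by
  obtain ⟨N, hN⟩ := eventually_atTop.1 h
  exact ⟨hx, fun k => t (k + N), fun k => wk (k + N), fun k => ht _,
    (tendsto_add_atTop_iff_nat N).2 ht0, (tendsto_add_atTop_iff_nat N).2 hw,
    fun k => hN _ (Nat.le_add_left _ _)⟩

end Tangents

/-! ### Graphical derivative of the normal cone of a cone at its apex -/

section ConeDerivative

variable {X : Type*} [NormedAddCommGroup X] [InnerProductSpace ℝ X]
  {C : Set X} {μ a b : X}

/-- Difference quotients of the normal cone mapping of a closed convex cone `C` at `(0, μ)` can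
only converge to normals of the critical cone. -/
theorem IsClosedConvexCone.mem_normalCone_critical (hC : IsClosedConvexCone C)
    (hμ : μ ∈ normalCone C 0) {t : ℕ → ℝ} {ak bk : ℕ → X} (ht : ∀ᶠ k in atTop, 0 < t k)
    (ht0 : Tendsto t atTop (𝓝 0)) (ha : Tendsto ak atTop (𝓝 a)) (hb : Tendsto bk atTop (𝓝 b))
    (h : ∀ᶠ k in atTop, μ + t k • bk k ∈ normalCone C (t k • ak k)) :
    b ∈ normalCone {x | x ∈ C ∧ ⟪μ, x⟫_ℝ = 0} a := by
  have hμC := ((hC.mem_normalCone_iff).1 hμ).2.2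
  have key : ∀ᶠ k in atTop, ak k ∈ C ∧ ⟪μ + t k • bk k, ak k⟫_ℝ = 0 ∧ 0 ≤ ⟪bk k, ak k⟫_ℝ ∧
      ∀ y ∈ C, ⟪μ, y⟫_ℝ = 0 → ⟪bk k, y⟫_ℝ ≤ 0 := by
    filter_upwards [ht, h] with k hk h
    obtain ⟨h1, h2, h3⟩ := hC.mem_normalCone_iff.1 h
    rw [hC.smul_mem_iff hk] at h1
    rw [inner_smul_right, mul_eq_zero, or_iff_right hk.ne'] at h2
    refine ⟨h1, h2, ?_, fun y hy hy0 => ?_⟩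
    · rw [inner_add_left, inner_smul_left] at h2
      have := hμC _ h1
      simp only [conj_trivial] at h2
      by_contra! hneg
      nlinarith
    · have := h3 y hy
      rw [inner_add_left, inner_smul_left, hy0, zero_add] at this
      simp only [conj_trivial] at this
      by_contra! hneg
      nlinarith
  have haC : a ∈ C := hC.isClosed.mem_of_tendsto ha (key.mono fun k hk => hk.1)
  have haμ : ⟪μ, a⟫_ℝ = 0 := by
    have h1 : Tendsto (fun k => ⟪μ + t k • bk k, ak k⟫_ℝ) atTop (𝓝 ⟪μ + (0 : ℝ) • b, a⟫_ℝ) :=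
      (tendsto_const_nhds.add (ht0.smul hb)).inner ha
    have h2 := tendsto_nhds_unique_of_eventuallyEq h1 tendsto_const_nhds
      (key.mono fun k hk => hk.2.1)
    simpa using h2
  have hbK : ∀ y ∈ C, ⟪μ, y⟫_ℝ = 0 → ⟪b, y⟫_ℝ ≤ 0 := fun y hy hy0 =>
    le_of_tendsto (hb.inner tendsto_const_nhds) (key.mono fun k hk => hk.2.2.2 y hy hy0)
  rw [(hC.inter_orthogonal μ).mem_normalCone_iff]
  refine ⟨⟨haC, haμ⟩, le_antisymm (hbK a haC haμ) ?_, fun y hy => hbK y hy.1 hy.2⟩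
  exact ge_of_tendsto (hb.inner ha) (key.mono fun k hk => hk.2.2.1)

/-- Conversely every normal of the critical cone is a limit of difference quotients of the normal
cone mapping. The approximating points are the projections of `μ + t (a + b)` onto `C`: divided by
`t`, they minimize `‖x - (a + b)‖² - 2 ⟪μ, x⟫ / t` over `C`, a penalty problem whose solutions tend
to the projection `a` of `a + b` onto the critical cone. -/
theorem IsClosedConvexCone.exists_tendsto_of_mem_normalCone_critical [FiniteDimensional ℝ X]
    (hC : IsClosedConvexCone C) (hμ : μ ∈ normalCone C 0)
    (hb : b ∈ normalCone {x | x ∈ C ∧ ⟪μ, x⟫_ℝ = 0} a) {t : ℕ → ℝ} (ht : ∀ k, 0 < t k)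
    (ht0 : Tendsto t atTop (𝓝 0)) :
    ∃ ak bk : ℕ → X, Tendsto ak atTop (𝓝 a) ∧ Tendsto bk atTop (𝓝 b) ∧
      ∀ k, μ + t k • bk k ∈ normalCone C (t k • ak k) := by
  have : CompleteSpace X := FiniteDimensional.complete ℝ X
  have hμC := (hC.mem_normalCone_iff.1 hμ).2.2
  obtain ⟨⟨haC, haμ⟩, hba, hbK⟩ := (hC.inter_orthogonal μ).mem_normalCone_iff.1 hb
  have proj : ∀ k, ∃ x, t k • x ∈ C ∧ μ + t k • (a + b - x) ∈ normalCone C (t k • x) := by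
    intro k
    obtain ⟨p, hp, hp'⟩ := exists_norm_eq_iInf_of_complete_convex hC.nonempty
      hC.isClosed.isComplete hC.convex (μ + t k • (a + b))
    rw [norm_eq_iInf_iff_real_inner_le_zero hC.convex hp] at hp'
    have e : t k • (t k)⁻¹ • p = p := by rw [smul_smul, mul_inv_cancel₀ (ht k).ne', one_smul]
    refine ⟨(t k)⁻¹ • p, by rwa [e], ?_⟩
    rw [mem_normalCone_iff_of_convex hC.convex, smul_sub, e, ← add_sub_assoc]
    exact ⟨hp, hp'⟩
  choose x hxC hx using proj
  have hxC : ∀ k, x k ∈ C := fun k => (hC.smul_mem_iff (ht k)).1 (hxC k)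
  -- the variational inequality of the projection, tested with `a`
  have est : ∀ k, t k * (‖a - x k‖ ^ 2 - ⟪b, x k⟫_ℝ) ≤ ⟪μ, x k⟫_ℝ := by
    intro k
    have h1 := ((mem_normalCone_iff_of_convex hC.convex).1 (hx k)).2 (t k • a)
      (hC.smul_mem _ (ht k).le a haC)
    rw [← smul_sub, inner_smul_right] at h1
    have h1 : ⟪μ + t k • (a + b - x k), a - x k⟫_ℝ ≤ 0 := by
      by_contra! hneg
      have := mul_pos (ht k) hneg
      linarith
    have e : a + b - x k = (a - x k) + b := by abel
    rw [inner_add_left, inner_smul_left, inner_sub_right, haμ, e, inner_add_left,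
      real_inner_self_eq_norm_sq, inner_sub_right b, hba, conj_trivial] at h1
    linarith
  have est1 : ∀ k, ‖a - x k‖ ^ 2 ≤ ⟪b, x k⟫_ℝ := fun k => by
    have := (est k).trans (hμC _ (hxC k))
    by_contra! hneg
    have := mul_pos (ht k) (sub_pos.2 hneg)
    linarith
  have est2 : ∀ k, ⟪b, x k⟫_ℝ ≤ ‖b‖ * ‖a - x k‖ := fun k => by
    have h1 := real_inner_le_norm b (x k - a)
    rw [inner_sub_right, hba, sub_zero, norm_sub_rev] at h1
    exact h1
  have est3 : ∀ k, ‖a - x k‖ ≤ ‖b‖ := fun k => by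
    by_contra! hneg
    have := (est1 k).trans (est2 k)
    nlinarith [norm_nonneg b, norm_nonneg (a - x k)]
  have est4 : ∀ k, -(t k * ‖b‖ ^ 2) ≤ ⟪μ, x k⟫_ℝ := fun k => by
    refine le_trans ?_ (est k)
    have h1 : ⟪b, x k⟫_ℝ ≤ ‖b‖ ^ 2 := (est2 k).trans (by nlinarith [est3 k, norm_nonneg b])
    nlinarith [ht k, sq_nonneg ‖a - x k‖]
  have hμx : Tendsto (fun k => ⟪μ, x k⟫_ℝ) atTop (𝓝 0) := by
    refine tendsto_of_tendsto_of_tendsto_of_le_of_le ?_ tendsto_const_nhds est4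
      fun k => hμC _ (hxC k)
    simpa using (ht0.mul_const (‖b‖ ^ 2)).neg
  have hxa : Tendsto x atTop (𝓝 a) := by
    refine (isCompact_closedBall a ‖b‖).tendsto_nhds_of_unique_mapClusterPt
      (Eventually.of_forall fun k => by rw [mem_closedBall_iff_norm, norm_sub_rev]; exact est3 k) ?_
    intro y _ hy
    obtain ⟨φ, hφ, hlim⟩ := hy.tendsto_subseq
    have hyC : y ∈ C := hC.isClosed.mem_of_tendsto hlim (Eventually.of_forall fun k => hxC _)
    have hyμ : ⟪μ, y⟫_ℝ = 0 := tendsto_nhds_unique (tendsto_const_nhds.inner hlim)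
      (hμx.comp hφ.tendsto_atTop)
    have h1 : ‖a - y‖ ^ 2 ≤ ⟪b, y⟫_ℝ := le_of_tendsto_of_tendsto'
      ((tendsto_const_nhds.sub hlim).norm.pow 2) (tendsto_const_nhds.inner hlim) fun k => est1 _
    have h2 := h1.trans (hbK y ⟨hyC, hyμ⟩)
    have h3 : ‖a - y‖ = 0 := by nlinarith [norm_nonneg (a - y), sq_nonneg ‖a - y‖]
    exact (sub_eq_zero.1 (norm_eq_zero.1 h3)).symm
  refine ⟨x, fun k => a + b - x k, hxa, ?_, hx⟩
  simpa using (tendsto_const_nhds (x := a + b)).sub hxa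

end ConeDerivative

/-! ### Preimages under submersions -/

theorem tendsto_clm_apply {ι X Z : Type*} [NormedAddCommGroup X] [NormedSpace ℝ X]
    [NormedAddCommGroup Z] [NormedSpace ℝ Z] {l : Filter ι} {A : ι → X →L[ℝ] Z} {A₀ : X →L[ℝ] Z}
    {x : ι → X} {x₀ : X} (hA : Tendsto A l (𝓝 A₀)) (hx : Tendsto x l (𝓝 x₀)) :
    Tendsto (fun i => A i (x i)) l (𝓝 (A₀ x₀)) :=
  (isBoundedBilinearMap_apply.continuous.tendsto (A₀, x₀)).comp (hA.prodMk_nhds hx)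

section Submersion

variable {Y E : Type*} [NormedAddCommGroup Y] [InnerProductSpace ℝ Y] [CompleteSpace Y]
  [NormedAddCommGroup E] [InnerProductSpace ℝ E] [CompleteSpace E]

/-- Regular normals pull back along any differentiable map of the sets: if `φ` maps `Ω` into `Ω'`
near `a`, the adjoint of its derivative maps regular normals of `Ω'` to regular normals of `Ω`. -/
theorem adjoint_mem_regularNormalCone {φ : Y → E} {L : Y →L[ℝ] E} {a : Y} (hφ : HasFDerivAt φ L a)
    {Ω : Set Y} {Ω' : Set E} (ha : a ∈ Ω) (hmaps : ∀ᶠ x in 𝓝[Ω] a, φ x ∈ Ω') {v : E}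
    (hv : v ∈ regularNormalCone Ω' (φ a)) :
    ContinuousLinearMap.adjoint L v ∈ regularNormalCone Ω a := by
  refine ⟨ha, fun ε hε => ?_⟩
  set δ : ℝ := ε / (2 * (‖v‖ + 1)) with hδ
  have hδ0 : 0 < δ := by positivity
  set ε' : ℝ := ε / (2 * (‖L‖ + δ)) with hε'
  have hε'0 : 0 < ε' := by positivity
  have hlim : Tendsto φ (𝓝[Ω] a) (𝓝[Ω'] (φ a)) :=
    tendsto_nhdsWithin_iff.2 ⟨hφ.continuousAt.continuousWithinAt, hmaps⟩
  filter_upwards [hlim.eventually (hv.2 ε' hε'0),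
    nhdsWithin_le_nhds (hφ.isLittleO.def hδ0)] with x h1 h2
  rw [ContinuousLinearMap.adjoint_inner_left]
  have h3 : ‖φ x - φ a‖ ≤ (‖L‖ + δ) * ‖x - a‖ := by
    calc ‖φ x - φ a‖ = ‖L (x - a) + (φ x - φ a - L (x - a))‖ := by congr 1; abel
      _ ≤ ‖L (x - a)‖ + ‖φ x - φ a - L (x - a)‖ := norm_add_le _ _
      _ ≤ ‖L‖ * ‖x - a‖ + δ * ‖x - a‖ := add_le_add (L.le_opNorm _) h2
      _ = _ := by ring
  have e : ⟪v, L (x - a)⟫_ℝ = ⟪v, φ x - φ a⟫_ℝ - ⟪v, φ x - φ a - L (x - a)⟫_ℝ := by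
    rw [← inner_sub_right]; congr 1; abel
  have h4 : -⟪v, φ x - φ a - L (x - a)⟫_ℝ ≤ ‖v‖ * (δ * ‖x - a‖) := by
    refine (neg_le_abs _).trans ((abs_real_inner_le_norm _ _).trans ?_)
    gcongr
  have h5 : ε' * ‖φ x - φ a‖ ≤ ε / 2 * ‖x - a‖ := by
    calc ε' * ‖φ x - φ a‖ ≤ ε' * ((‖L‖ + δ) * ‖x - a‖) := by gcongr
      _ = ε / 2 * ‖x - a‖ := by
        have : ‖L‖ + δ ≠ 0 := by positivity
        rw [hε']; field_simp
  have h6 : ‖v‖ * (δ * ‖x - a‖) ≤ ε / 2 * ‖x - a‖ := by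
    have : ‖v‖ * δ ≤ ε / 2 := by
      rw [hδ, mul_div_assoc', div_le_div_iff₀ (by positivity) (by positivity)]
      nlinarith [norm_nonneg v]
    calc _ = ‖v‖ * δ * ‖x - a‖ := by ring
      _ ≤ _ := by gcongr
  linarith

/-- A submersion `h` at `y` has a differentiable family of local right inverses `x ↦ g (x, d)`,
the parameter `d` prescribing the position in the fibre to first order. -/
theorem exists_rightInverse_family [FiniteDimensional ℝ E] {h : Y → E} {J : Y →L[ℝ] E} {y : Y}
    (hJ : HasStrictFDerivAt h J y) (hsurj : Function.Surjective J) :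
    ∃ (G : E →L[ℝ] Y) (g : E × Y → Y) (g' : E × Y →L[ℝ] Y), (∀ e, J (G e) = e) ∧
      (∀ p, g' p = p.2 + G (p.1 - J p.2)) ∧ g (h y, 0) = y ∧ HasFDerivAt g g' (h y, 0) ∧
      ∀ᶠ p in 𝓝 (h y, (0 : Y)), h (g p) = p.1 := by
  obtain ⟨G₀, hG₀⟩ := (J : Y →ₗ[ℝ] E).exists_rightInverse_of_surjective
    (LinearMap.range_eq_top.2 hsurj)
  set G : E →L[ℝ] Y := LinearMap.toContinuousLinearMap G₀ with hG
  have hJG : ∀ e, J (G e) = e := fun e => LinearMap.congr_fun hG₀ e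
  -- the local inverse of `(e, d) ↦ (h (y + d + G e), d)`, whose derivative is `(e, d) ↦ (e + J d, d)`
  let inner' : E × Y →L[ℝ] Y := ContinuousLinearMap.snd ℝ E Y + G ∘L ContinuousLinearMap.fst ℝ E Y
  let D : (E × Y) ≃L[ℝ] (E × Y) :=
    ContinuousLinearEquiv.equivOfInverse
      ((J ∘L inner').prod (ContinuousLinearMap.snd ℝ E Y))
      ((ContinuousLinearMap.fst ℝ E Y - J ∘L ContinuousLinearMap.snd ℝ E Y).prod
        (ContinuousLinearMap.snd ℝ E Y))
      (fun p => by ext <;> simp [inner', hJG]) (fun p => by ext <;> simp [inner', hJG])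
  let Φ : E × Y → E × Y := fun p => (h (y + inner' p), p.2)
  have hΦ : HasStrictFDerivAt Φ (D : E × Y →L[ℝ] E × Y) (0, 0) := by
    have h1 : HasStrictFDerivAt (fun p => y + inner' p) inner' (0, 0) :=
      (inner'.hasStrictFDerivAt).const_add y
    have h2 : HasStrictFDerivAt h J (y + inner' (0, 0)) := by
      simpa [inner'] using hJ
    exact (HasStrictFDerivAt.comp (g := h) (f := fun p => y + inner' p) (0, 0) h2 h1).prodMk
      hasStrictFDerivAt_snd
  have hΦ0 : Φ (0, 0) = (h y, 0) := by simp [Φ, inner']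
  have hinv := hΦ.to_localInverse
  have hright := hΦ.eventually_right_inverse
  rw [hΦ0] at hinv hright
  set Ψ := hΦ.localInverse Φ D (0, 0)
  have hΨ0 : Ψ (h y, 0) = (0, 0) := by
    rw [← hΦ0]; exact hΦ.localInverse_apply_image
  refine ⟨G, fun p => y + inner' (Ψ p), inner' ∘L (D.symm : E × Y →L[ℝ] E × Y), hJG, ?_, ?_, ?_, ?_⟩
  · intro p
    have hD : D.symm p = (p.1 - J p.2, p.2) := rfl
    simp [inner', hD]
  · simp [hΨ0, inner']
  · have := (inner'.hasFDerivAt (x := Ψ (h y, 0))).comp _ hinv.hasFDerivAt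
    exact this.const_add y
  · filter_upwards [hright] with p hp
    exact congrArg Prod.fst hp

/-- Regular normals of a preimage under a submersion: `N̂_Ω(y) = ∇h(y)^* N̂_C(h(y))`. -/
theorem mem_regularNormalCone_preimage_iff [FiniteDimensional ℝ E] {h : Y → E} {J : Y →L[ℝ] E}
    {y : Y} (hJ : HasStrictFDerivAt h J y) (hsurj : Function.Surjective J) {Ω : Set Y} {C : Set E}
    (hΩ : ∀ᶠ y' in 𝓝 y, y' ∈ Ω ↔ h y' ∈ C) {v : Y} :
    v ∈ regularNormalCone Ω y ↔
      ∃ η ∈ regularNormalCone C (h y), v = ContinuousLinearMap.adjoint J η := by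
  constructor
  · intro hv
    obtain ⟨G, g, g', hJG, hg', hg0, hg, hright⟩ := exists_rightInverse_family hJ hsurj
    have hy : h y ∈ C := (hΩ.self_of_nhds).1 hv.1
    have hgΩ : ∀ᶠ p in 𝓝 (h y, (0 : Y)), p.1 ∈ C → g p ∈ Ω := by
      have := hg.continuousAt.tendsto
      rw [hg0] at this
      filter_upwards [hright, this.eventually hΩ] with p h1 h2 h3
      rw [h2, h1]
      exact h3
    -- moving along the fibre shows that `v` is orthogonal to the kernel of the derivative
    have hfib : HasFDerivAt (fun d : Y => g (h y, d)) (g' ∘L ContinuousLinearMap.inr ℝ E Y) 0 :=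
      HasFDerivAt.comp (f := fun d : Y => (h y, d)) (0 : Y) hg (hasFDerivAt_prodMk_right _ _)
    have hsec : HasFDerivAt (fun x : E => g (x, 0)) (g' ∘L ContinuousLinearMap.inl ℝ E Y) (h y) :=
      HasFDerivAt.comp (f := fun x : E => (x, (0 : Y))) (h y) hg (hasFDerivAt_prodMk_left _ _)
    have h1 : ContinuousLinearMap.adjoint (g' ∘L ContinuousLinearMap.inr ℝ E Y) v = 0 := by
      have hmem : ContinuousLinearMap.adjoint (g' ∘L ContinuousLinearMap.inr ℝ E Y) v ∈
          regularNormalCone (univ : Set Y) 0 := by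
        refine adjoint_mem_regularNormalCone (Ω' := Ω) hfib (mem_univ _) ?_ (by rwa [hg0])
        rw [nhdsWithin_univ]
        have : Tendsto (fun d : Y => (h y, d)) (𝓝 0) (𝓝 (h y, 0)) :=
          (Continuous.prodMk_right (h y)).tendsto 0
        filter_upwards [this.eventually hgΩ] with d hd
        exact hd hy
      have := ((mem_regularNormalCone_iff_of_convex convex_univ).1 hmem).2 _ (mem_univ
        (ContinuousLinearMap.adjoint (g' ∘L ContinuousLinearMap.inr ℝ E Y) v))
      rw [sub_zero] at this
      exact inner_self_eq_zero.1 (le_antisymm this real_inner_self_nonneg)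
    refine ⟨ContinuousLinearMap.adjoint (g' ∘L ContinuousLinearMap.inl ℝ E Y) v, ?_, ?_⟩
    · refine adjoint_mem_regularNormalCone (Ω' := Ω) hsec hy ?_ (by rwa [hg0])
      have : Tendsto (fun x : E => (x, (0 : Y))) (𝓝 (h y)) (𝓝 (h y, 0)) :=
        (Continuous.prodMk_left (0 : Y)).tendsto _
      filter_upwards [nhdsWithin_le_nhds (this.eventually hgΩ), self_mem_nhdsWithin] with x hx hx'
      exact hx hx'
    · refine ext_inner_right ℝ fun w => ?_
      have h2 := congrArg (fun x => ⟪x, w⟫_ℝ) h1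
      simp only [ContinuousLinearMap.adjoint_inner_left, inner_zero_left] at h2 ⊢
      simp only [ContinuousLinearMap.comp_apply, ContinuousLinearMap.inr_apply,
        ContinuousLinearMap.inl_apply, hg', inner_add_right, zero_sub, map_neg, inner_neg_right,
        map_zero, sub_zero, zero_add] at h2 ⊢
      linarith
  · rintro ⟨η, hη, rfl⟩
    refine adjoint_mem_regularNormalCone hJ.hasFDerivAt ((hΩ.self_of_nhds).2 hη.1) ?_ hη
    filter_upwards [nhdsWithin_le_nhds hΩ, self_mem_nhdsWithin] with y' h1 h2
    exact h1.1 h2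

/-- Surjectivity is an open condition, and the adjoints of the derivatives of a submersion have
left inverses that depend continuously on the point. -/
theorem exists_leftInverse_adjoint [FiniteDimensional ℝ E] {J : Y → Y →L[ℝ] E} {z : Y}
    (hJ : ContinuousAt J z) (hsurj : Function.Surjective (J z)) :
    (∀ᶠ y in 𝓝 z, Function.Surjective (J y)) ∧ ∃ L : Y → Y →L[ℝ] E, ContinuousAt L z ∧
      ∀ᶠ y in 𝓝 z, ∀ η, L y (ContinuousLinearMap.adjoint (J y) η) = η := by
  obtain ⟨G₀, hG₀⟩ := (J z : Y →ₗ[ℝ] E).exists_rightInverse_of_surjective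
    (LinearMap.range_eq_top.2 hsurj)
  set G : E →L[ℝ] Y := LinearMap.toContinuousLinearMap G₀ with hG
  have hJG : J z ∘L G = 1 := ContinuousLinearMap.ext fun e => LinearMap.congr_fun hG₀ e
  have hA : ContinuousAt (fun y => J y ∘L G) z := hJ.clm_comp continuousAt_const
  have hunit : ∀ᶠ y in 𝓝 z, IsUnit (J y ∘L G) := by
    refine hA.eventually (p := fun A => IsUnit A) ?_
    show ∀ᶠ A in 𝓝 (J z ∘L G), IsUnit A
    rw [hJG]
    exact Units.isOpen.mem_nhds isUnit_one
  have hR : ContinuousAt (fun y => G ∘L Ring.inverse (J y ∘L G)) z := by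
    refine continuousAt_const.clm_comp ?_
    refine ContinuousAt.comp (g := Ring.inverse) ?_ hA
    rw [hJG]
    exact NormedRing.inverse_continuousAt (1 : (E →L[ℝ] E)ˣ)
  have hJR : ∀ᶠ y in 𝓝 z, ∀ e, J y ((G ∘L Ring.inverse (J y ∘L G)) e) = e := by
    filter_upwards [hunit] with y hy e
    exact DFunLike.congr_fun (Ring.mul_inverse_cancel _ hy) e
  refine ⟨hJR.mono fun y hy e => ⟨_, hy e⟩,
    fun y => ContinuousLinearMap.adjoint (G ∘L Ring.inverse (J y ∘L G)), ?_, ?_⟩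
  · exact (ContinuousLinearMap.adjoint (𝕜 := ℝ) (E := E) (F := Y)).continuous.continuousAt.comp hR
  · filter_upwards [hJR] with y hy η
    refine ext_inner_right ℝ fun w => ?_
    rw [ContinuousLinearMap.adjoint_inner_left, ContinuousLinearMap.adjoint_inner_left, hy]

/-- Limiting normals of the preimage of a convex set under a submersion. -/
theorem mem_normalCone_preimage_iff [FiniteDimensional ℝ E] {h : Y → E} {z : Y}
    (hh : ContDiffAt ℝ 1 h z) (hsurj : Function.Surjective (fderiv ℝ h z)) {Ω : Set Y} {C : Set E}
    (hC : Convex ℝ C) (hΩ : ∀ᶠ y in 𝓝 z, y ∈ Ω ↔ h y ∈ C) {v : Y} :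
    v ∈ normalCone Ω z ↔
      ∃ η ∈ normalCone C (h z), v = ContinuousLinearMap.adjoint (fderiv ℝ h z) η := by
  constructor
  · rintro ⟨hz, y, vk, hy, hv, hreg⟩
    have hJ : ContinuousAt (fderiv ℝ h) z :=
      (hh.fderiv_right (m := 0) (by norm_num)).continuousAt
    obtain ⟨hs, L, hL, hLJ⟩ := exists_leftInverse_adjoint hJ hsurj
    have key : ∀ᶠ k in atTop, ∃ η ∈ regularNormalCone C (h (y k)),
        vk k = ContinuousLinearMap.adjoint (fderiv ℝ h (y k)) η := by
      filter_upwards [hy.eventually hs, hy.eventually (hΩ.eventually_nhds),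
        hy.eventually ((hh.eventually (by simp)))] with k h1 h2 h3
      exact (mem_regularNormalCone_preimage_iff (h3.hasStrictFDerivAt (by simp)) h1 h2).1 (hreg k)
    set η := L z v with hη
    have hηk : Tendsto (fun k => L (y k) (vk k)) atTop (𝓝 η) :=
      tendsto_clm_apply (hL.tendsto.comp hy) hv
    have key2 : ∀ᶠ k in atTop, L (y k) (vk k) ∈ regularNormalCone C (h (y k)) ∧
        vk k = ContinuousLinearMap.adjoint (fderiv ℝ h (y k)) (L (y k) (vk k)) := by
      filter_upwards [key, hy.eventually hLJ] with k ⟨η, h1, h2⟩ h3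
      rw [h2, h3]
      exact ⟨h1, rfl⟩
    refine ⟨η, ?_, ?_⟩
    · rw [mem_normalCone_iff_of_convex hC]
      refine ⟨hΩ.self_of_nhds.1 hz, fun x hx => ?_⟩
      refine le_of_tendsto (hηk.inner (tendsto_const_nhds.sub (hh.continuousAt.tendsto.comp hy)))
        (key2.mono fun k hk => ?_)
      exact ((mem_regularNormalCone_iff_of_convex hC).1 hk.1).2 x hx
    · refine tendsto_nhds_unique_of_eventuallyEq hv ?_ (key2.mono fun k hk => hk.2)
      exact tendsto_clm_apply
        (((ContinuousLinearMap.adjoint (𝕜 := ℝ) (E := Y) (F := E)).continuous.tendsto _).comp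
          (hJ.tendsto.comp hy)) hηk
  · rintro ⟨η, hη, rfl⟩
    rw [normalCone_eq_regularNormalCone_of_convex hC] at hη
    exact regularNormalCone_subset_normalCone _ _ ((mem_regularNormalCone_preimage_iff
      (hh.hasStrictFDerivAt (by simp)) hsurj hΩ).2 ⟨η, hη, rfl⟩)

/-- Difference quotients along a convergent sequence of directions. -/
theorem tendsto_differenceQuotient {X Z : Type*} [NormedAddCommGroup X] [NormedSpace ℝ X]
    [NormedAddCommGroup Z] [NormedSpace ℝ Z] {h : X → Z} {J : X →L[ℝ] Z} {y : X}
    (hJ : HasFDerivAt h J y) {t : ℕ → ℝ} (ht : ∀ k, 0 < t k) (ht0 : Tendsto t atTop (𝓝 0)) {u : X}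
    {w : ℕ → X} (hw : Tendsto w atTop (𝓝 u)) :
    Tendsto (fun k => (t k)⁻¹ • (h (y + t k • w k) - h y)) atTop (𝓝 (J u)) := by
  refine (hasFDerivWithinAt_univ.2 hJ).lim (by simpa using ht0.smul hw)
    (Eventually.of_forall fun _ => mem_univ _) ?_
  refine hw.congr fun k => ?_
  rw [smul_smul, inv_mul_cancel₀ (ht k).ne', one_smul]

/-- Lyusternik-type lifting: every first-order expansion `h y + t x` along the direction `J u` is
attained by `h` along an expansion `y + t u`. -/
theorem exists_tendsto_lift [FiniteDimensional ℝ E] {h : Y → E} {J : Y →L[ℝ] E} {y : Y}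
    (hJ : HasStrictFDerivAt h J y) (hsurj : Function.Surjective J) {t : ℕ → ℝ}
    (ht : ∀ k, 0 < t k) (ht0 : Tendsto t atTop (𝓝 0)) {u : Y} {x : ℕ → E}
    (hx : Tendsto x atTop (𝓝 (J u))) :
    ∃ w : ℕ → Y, Tendsto w atTop (𝓝 u) ∧ ∀ᶠ k in atTop, h (y + t k • w k) = h y + t k • x k := by
  obtain ⟨G, g, g', hJG, hg', hg0, hg, hright⟩ := exists_rightInverse_family hJ hsurj
  have hd : Tendsto (fun k => t k • (x k, u)) atTop (𝓝 0) := by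
    have := ht0.smul (hx.prodMk_nhds (tendsto_const_nhds (x := u)))
    simpa using this
  refine ⟨fun k => (t k)⁻¹ • (g ((h y, 0) + t k • (x k, u)) - g (h y, 0)), ?_, ?_⟩
  · simpa [hg'] using tendsto_differenceQuotient hg ht ht0 (hx.prodMk_nhds (tendsto_const_nhds (x := u)))
  · have := hd.const_add (h y, (0 : Y))
    rw [add_zero] at this
    filter_upwards [this.eventually hright] with k hk
    rw [smul_smul, mul_inv_cancel₀ (ht k).ne', one_smul, hg0, add_sub_cancel, hk]
    rfl

/-- The Bouligand tangent cone of the preimage of a closed convex cone under a submersion. -/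
theorem mem_tangentCone_preimage_iff [FiniteDimensional ℝ E] {h : Y → E} {J : Y →L[ℝ] E} {z : Y}
    (hJ : HasStrictFDerivAt h J z) (hsurj : Function.Surjective J) (hz : h z = 0) {Ω : Set Y}
    {C : Set E} (hC : IsClosedConvexCone C) (hΩ : ∀ᶠ y in 𝓝 z, y ∈ Ω ↔ h y ∈ C) {w : Y} :
    w ∈ tangentCone Ω z ↔ J w ∈ C := by
  have hconv : ∀ {t : ℕ → ℝ} {wk : ℕ → Y}, Tendsto t atTop (𝓝 0) → Tendsto wk atTop (𝓝 w) →
      Tendsto (fun k => z + t k • wk k) atTop (𝓝 z) := fun ht0 hw => by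
    simpa using (ht0.smul hw).const_add z
  constructor
  · rintro ⟨hzΩ, t, wk, ht, ht0, hw, hmem⟩
    refine hC.isClosed.mem_of_tendsto (tendsto_differenceQuotient hJ.hasFDerivAt ht ht0 hw) ?_
    filter_upwards [(hconv ht0 hw).eventually hΩ] with k hk
    rw [hz, sub_zero]
    exact hC.smul_mem _ (inv_nonneg.2 (ht k).le) _ (hk.1 (hmem k))
  · intro hw
    have ht : ∀ k : ℕ, 0 < 1 / ((k : ℝ) + 1) := fun k => by positivity
    obtain ⟨wk, hwk, hlift⟩ := exists_tendsto_lift hJ hsurj ht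
      tendsto_one_div_add_atTop_nhds_zero_nat (tendsto_const_nhds (x := J w))
    refine mem_tangentCone_of_eventually (hΩ.self_of_nhds.2 (hz ▸ hC.zero_mem)) ht
      tendsto_one_div_add_atTop_nhds_zero_nat hwk ?_
    filter_upwards [hlift, (hconv tendsto_one_div_add_atTop_nhds_zero_nat hwk).eventually hΩ]
      with k h1 h2
    rw [h2, h1, hz, zero_add]
    exact hC.smul_mem _ (ht k).le _ hw

end Submersion

/-! ### The general formula for the graphical derivative -/

section GeneralFormula

variable {Y E : Type*} [NormedAddCommGroup Y] [InnerProductSpace ℝ Y]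
  [NormedAddCommGroup E] [InnerProductSpace ℝ E]

theorem gradient_inner_comp [CompleteSpace Y] [CompleteSpace E] {h : Y → E} {y : Y}
    (hh : DifferentiableAt ℝ h y) (μ : E) :
    gradient (fun y => ⟪μ, h y⟫_ℝ) y = ContinuousLinearMap.adjoint (fderiv ℝ h y) μ := by
  refine HasGradientAt.gradient ?_
  rw [hasGradientAt_iff_hasFDerivAt]
  have h1 : HasFDerivAt (fun y => ⟪μ, h y⟫_ℝ) (innerSL ℝ μ ∘L fderiv ℝ h y) y :=
    (innerSL ℝ μ).hasFDerivAt.comp y hh.hasFDerivAt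
  have h2 : InnerProductSpace.toDual ℝ Y (ContinuousLinearMap.adjoint (fderiv ℝ h y) μ) =
      innerSL ℝ μ ∘L fderiv ℝ h y := by
    ext w
    simp [ContinuousLinearMap.adjoint_inner_left]
  rwa [h2]

theorem IsConeReduction.contDiffAt {Θ : Set Y} {C : Set E} {h : Y → E} {z : Y}
    (hred : IsConeReduction Θ z C h) : ContDiffAt ℝ 2 h z := by
  obtain ⟨O, hO, hz, hh, -⟩ := hred.reduces
  exact hh.contDiffAt (hO.mem_nhds hz)

theorem IsConeReduction.eventually_mem_iff {Θ : Set Y} {C : Set E} {h : Y → E} {z : Y}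
    (hred : IsConeReduction Θ z C h) : ∀ᶠ y in 𝓝 z, y ∈ Θ ↔ h y ∈ C := by
  obtain ⟨O, hO, hz, -, hΘ⟩ := hred.reduces
  filter_upwards [hO.mem_nhds hz] with y hy
  have := Set.ext_iff.1 hΘ y
  simpa [hy] using this

/-- Near the reduction point the normal cone mapping is `y ↦ ∇h(y)^* N_C(h(y))`. -/
theorem IsConeReduction.eventually_mem_normalCone_iff [CompleteSpace Y] [FiniteDimensional ℝ E]
    [CompleteSpace E] {Θ : Set Y} {C : Set E} {h : Y → E} {z : Y} (hred : IsConeReduction Θ z C h) :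
    ∀ᶠ y in 𝓝 z, ∀ v, v ∈ normalCone Θ y ↔
      ∃ η ∈ normalCone C (h y), v = ContinuousLinearMap.adjoint (fderiv ℝ h y) η := by
  have hJ : ContinuousAt (fderiv ℝ h) z :=
    (hred.contDiffAt.fderiv_right (m := 1) (by norm_num)).continuousAt
  filter_upwards [(exists_leftInverse_adjoint hJ hred.surjective).1,
    hred.eventually_mem_iff.eventually_nhds, hred.contDiffAt.eventually (by simp)]
    with y h1 h2 h3 v
  exact mem_normalCone_preimage_iff (h3.of_le one_le_two) h1 hred.cone.convex h2

variable [FiniteDimensional ℝ Y]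

/-- The curvature term as a linear operator. -/
noncomputable def curvatureCLM (h : Y → E) (μ : E) (z : Y) : Y →L[ℝ] Y :=
  haveI : CompleteSpace Y := FiniteDimensional.complete ℝ Y
  fderiv ℝ (gradient fun y => ⟪μ, h y⟫_ℝ) z

/-- For a `C²` mapping the curvature term is the derivative of `y ↦ ∇h(y)^* μ`. -/
theorem hasFDerivAt_adjoint_fderiv [CompleteSpace Y] [CompleteSpace E] {h : Y → E} {z : Y}
    (hh : ContDiffAt ℝ 2 h z) (μ : E) :
    HasFDerivAt (fun y => ContinuousLinearMap.adjoint (fderiv ℝ h y) μ) (curvatureCLM h μ z) z := by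
  have hdiff : DifferentiableAt ℝ (fderiv ℝ h) z :=
    (hh.fderiv_right (m := 1) (by norm_num)).differentiableAt (by norm_num)
  let T : (Y →L[ℝ] E) →+ Y :=
    { toFun := fun A => ContinuousLinearMap.adjoint A μ
      map_zero' := by simp
      map_add' := fun A B => by simp }
  have hT : Continuous T := by
    have := (ContinuousLinearMap.adjoint (𝕜 := ℝ) (E := Y) (F := E)).continuous
    exact (ContinuousLinearMap.apply ℝ Y μ).continuous.comp this
  have h1 : DifferentiableAt ℝ (fun y => ContinuousLinearMap.adjoint (fderiv ℝ h y) μ) z :=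
    ((T.toRealLinearMap hT).differentiableAt (x := fderiv ℝ h z)).comp z hdiff
  have h2 : (gradient fun y => ⟪μ, h y⟫_ℝ) =ᶠ[𝓝 z]
      fun y => ContinuousLinearMap.adjoint (fderiv ℝ h y) μ := by
    filter_upwards [hh.eventually (by simp)] with y hy
    exact gradient_inner_comp (hy.differentiableAt (by simp)) μ
  have h3 := h1.hasFDerivAt
  rw [← h2.fderiv_eq] at h3
  exact h3

variable [FiniteDimensional ℝ E]

/-- The curvature term in weak form. -/
theorem hasFDerivAt_inner_fderiv {h : Y → E} {z : Y} (hh : ContDiffAt ℝ 2 h z) (μ : E) (w : Y) :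
    HasFDerivAt (fun y => ⟪μ, fderiv ℝ h y w⟫_ℝ) (innerSL ℝ w ∘L curvatureCLM h μ z) z := by
  have : CompleteSpace Y := FiniteDimensional.complete ℝ Y
  have : CompleteSpace E := FiniteDimensional.complete ℝ E
  have := (innerSL ℝ w).hasFDerivAt.comp z (hasFDerivAt_adjoint_fderiv hh μ)
  refine this.congr_of_eventuallyEq (Eventually.of_forall fun y => ?_)
  simp only [Function.comp, innerSL_apply_apply]
  rw [ContinuousLinearMap.adjoint_inner_right, real_inner_comm]

theorem adjoint_toLinearMap_eq [CompleteSpace Y] [CompleteSpace E] (J : Y →L[ℝ] E) (μ : E) :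
    LinearMap.adjoint (J : Y →ₗ[ℝ] E) μ = ContinuousLinearMap.adjoint J μ := by
  refine ext_inner_right ℝ fun w => ?_
  rw [LinearMap.adjoint_inner_left, ContinuousLinearMap.adjoint_inner_left]
  rfl

/-- Reduced multipliers exist and are unique, since `∇h(z)^*` is injective. -/
theorem IsConeReduction.existsUnique_multiplier {Θ : Set Y} {C : Set E} {h : Y → E} {z l : Y}
    (hred : IsConeReduction Θ z C h) (hl : l ∈ normalCone Θ z) :
    ∃! μ : E, IsReducedMultiplier C h z l μ := by
  have : CompleteSpace Y := FiniteDimensional.complete ℝ Y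
  have : CompleteSpace E := FiniteDimensional.complete ℝ E
  obtain ⟨μ, hμ, rfl⟩ := (mem_normalCone_preimage_iff (hred.contDiffAt.of_le one_le_two)
    hred.surjective hred.cone.convex hred.eventually_mem_iff).1 hl
  refine ⟨μ, ⟨(adjoint_toLinearMap_eq _ _).symm, hμ⟩, fun ν ⟨hν, _⟩ => ?_⟩
  rw [adjoint_toLinearMap_eq] at hν
  refine ext_inner_right ℝ fun e => ?_
  obtain ⟨w, rfl⟩ := hred.surjective e
  rw [← ContinuousLinearMap.adjoint_inner_left, ← ContinuousLinearMap.adjoint_inner_left, hν]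

/-- The critical cone of `Θ` is the preimage under `∇h(z)` of that of `C` at its apex, hence so are
its normals. -/
theorem IsConeReduction.mem_normalCone_criticalCone_iff [CompleteSpace Y] [CompleteSpace E]
    {Θ : Set Y} {C : Set E} {h : Y → E} {z l : Y} {μ : E}
    (hred : IsConeReduction Θ z C h) (hμ : IsReducedMultiplier C h z l μ) {u w : Y} :
    w ∈ normalCone (criticalCone Θ z l) u ↔
      ∃ η ∈ normalCone {x | x ∈ C ∧ ⟪μ, x⟫_ℝ = 0} (fderiv ℝ h z u),
        w = ContinuousLinearMap.adjoint (fderiv ℝ h z) η := by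
  have hK : criticalCone Θ z l = {w | fderiv ℝ h z w ∈ {x | x ∈ C ∧ ⟪μ, x⟫_ℝ = 0}} := by
    ext w
    have h1 : w ∈ tangentCone Θ z ↔ fderiv ℝ h z w ∈ C :=
      mem_tangentCone_preimage_iff (hred.contDiffAt.hasStrictFDerivAt (by simp)) hred.surjective
        hred.map_eq_zero hred.cone hred.eventually_mem_iff
    have h2 : ⟪l, w⟫_ℝ = ⟪μ, fderiv ℝ h z w⟫_ℝ := by
      rw [hμ.1, LinearMap.adjoint_inner_left]
      rfl
    simp only [criticalCone, mem_ofPred_eq, h1, h2]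
  have := mem_normalCone_preimage_iff (h := fderiv ℝ h z) (z := u) (v := w)
    (fderiv ℝ h z).contDiff.contDiffAt (by rw [ContinuousLinearMap.fderiv]; exact hred.surjective)
    (hred.cone.inter_orthogonal μ).convex (Ω := criticalCone Θ z l)
    (Eventually.of_forall fun y => by rw [hK]; rfl)
  rwa [ContinuousLinearMap.fderiv] at this

/-- The graphical derivative of the normal cone mapping of a reducible set. -/
theorem IsConeReduction.graphicalDerivative_normalCone
    {Θ : Set Y} {C : Set E} {h : Y → E} {z l : Y} {μ : E}
    (hred : IsConeReduction Θ z C h) (hl : l ∈ normalCone Θ z)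
    (hμ : IsReducedMultiplier C h z l μ) (u : Y) :
    graphicalDerivative (normalCone Θ) z l u =
      (fun w => curvature h μ z u + w) '' normalCone (criticalCone Θ z l) u := by
  have : CompleteSpace Y := FiniteDimensional.complete ℝ Y
  have : CompleteSpace E := FiniteDimensional.complete ℝ E
  have hlμ : l = ContinuousLinearMap.adjoint (fderiv ℝ h z) μ := by
    rw [← adjoint_toLinearMap_eq]; exact hμ.1
  have hμ0 : μ ∈ normalCone C 0 := by
    have := hμ.2
    rwa [hred.map_eq_zero] at this
  have hstrict : HasStrictFDerivAt h (fderiv ℝ h z) z :=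
    hred.contDiffAt.hasStrictFDerivAt (by simp)
  have hJ : ContinuousAt (fderiv ℝ h) z :=
    (hred.contDiffAt.fderiv_right (m := 1) (by norm_num)).continuousAt
  have hJadj : ContinuousAt (fun y => ContinuousLinearMap.adjoint (fderiv ℝ h y)) z :=
    (ContinuousLinearMap.adjoint (𝕜 := ℝ) (E := Y) (F := E)).continuous.continuousAt.comp hJ
  have hconv : ∀ {t : ℕ → ℝ} {uk : ℕ → Y}, Tendsto t atTop (𝓝 0) → Tendsto uk atTop (𝓝 u) →
      Tendsto (fun k => z + t k • uk k) atTop (𝓝 z) := fun ht0 hu => by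
    simpa using (ht0.smul hu).const_add z
  have hN := hred.eventually_mem_normalCone_iff
  have hcurv := hasFDerivAt_adjoint_fderiv hred.contDiffAt μ
  ext v
  constructor
  · rintro ⟨-, t, uv, ht, ht0, huv, hmem⟩
    have hu : Tendsto (fun k => (uv k).1) atTop (𝓝 u) := (continuous_fst.tendsto _).comp huv
    have hv : Tendsto (fun k => (uv k).2) atTop (𝓝 v) := (continuous_snd.tendsto _).comp huv
    have hmem : ∀ k, l + t k • (uv k).2 ∈ normalCone Θ (z + t k • (uv k).1) := hmem
    set y : ℕ → Y := fun k => z + t k • (uv k).1 with hy_def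
    have hy : Tendsto y atTop (𝓝 z) := hconv ht0 hu
    obtain ⟨-, L, hL, hLJ⟩ := exists_leftInverse_adjoint hJ hred.surjective
    have h1 : ∀ᶠ k in atTop, ∃ η ∈ normalCone C (h (y k)),
        l + t k • (uv k).2 = ContinuousLinearMap.adjoint (fderiv ℝ h (y k)) η := by
      filter_upwards [hy.eventually hN] with k hk
      exact (hk _).1 (hmem k)
    -- `q k = ∇h(y k)^* ((η k - μ) / t k)` converges, hence so does `(η k - μ) / t k`
    set q : ℕ → Y := fun k => (uv k).2 - (t k)⁻¹ •
      (ContinuousLinearMap.adjoint (fderiv ℝ h (y k)) μ -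
        ContinuousLinearMap.adjoint (fderiv ℝ h z) μ) with hq
    have hqlim : Tendsto q atTop (𝓝 (v - curvature h μ z u)) :=
      hv.sub (tendsto_differenceQuotient hcurv ht ht0 hu)
    have hb : Tendsto (fun k => L (y k) (q k)) atTop (𝓝 (L z (v - curvature h μ z u))) :=
      tendsto_clm_apply (hL.tendsto.comp hy) hqlim
    have h2 : ∀ᶠ k in atTop, μ + t k • L (y k) (q k) ∈ normalCone C (h (y k)) ∧
        q k = ContinuousLinearMap.adjoint (fderiv ℝ h (y k)) (L (y k) (q k)) := by
      filter_upwards [h1, hy.eventually hLJ] with k ⟨η, hη, he⟩ hk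
      have hqk : q k = ContinuousLinearMap.adjoint (fderiv ℝ h (y k)) ((t k)⁻¹ • (η - μ)) := by
        rw [map_smul, map_sub, ← he, hq, ← hlμ]
        simp only [smul_sub, smul_add, smul_smul, inv_mul_cancel₀ (ht k).ne', one_smul]
        abel
      have hLq : L (y k) (q k) = (t k)⁻¹ • (η - μ) := by rw [hqk, hk]
      rw [hLq]
      refine ⟨?_, hqk⟩
      rwa [smul_smul, mul_inv_cancel₀ (ht k).ne', one_smul, add_sub_cancel]
    have ha := tendsto_differenceQuotient hstrict.hasFDerivAt ht ht0 hu
    have hK := hred.cone.mem_normalCone_critical hμ0 (Eventually.of_forall ht) ht0 ha hb (by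
      filter_upwards [h2] with k hk
      rw [smul_smul, mul_inv_cancel₀ (ht k).ne', one_smul, hred.map_eq_zero, sub_zero]
      exact hk.1)
    refine ⟨v - curvature h μ z u, ?_, by simp⟩
    rw [hred.mem_normalCone_criticalCone_iff hμ]
    refine ⟨_, hK, ?_⟩
    exact tendsto_nhds_unique_of_eventuallyEq hqlim
      (tendsto_clm_apply (hJadj.tendsto.comp hy) hb) (h2.mono fun k hk => hk.2)
  · rintro ⟨w, hw, rfl⟩
    obtain ⟨η, hη, rfl⟩ := (hred.mem_normalCone_criticalCone_iff hμ).1 hw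
    set t : ℕ → ℝ := fun k => 1 / ((k : ℝ) + 1) with ht_def
    have ht : ∀ k, 0 < t k := fun k => by positivity
    have ht0 : Tendsto t atTop (𝓝 0) := tendsto_one_div_add_atTop_nhds_zero_nat
    obtain ⟨ak, bk, ha, hb, hab⟩ :=
      hred.cone.exists_tendsto_of_mem_normalCone_critical hμ0 hη ht ht0
    obtain ⟨uk, hu, hlift⟩ := exists_tendsto_lift hstrict hred.surjective ht ht0 ha
    have hy := hconv ht0 hu
    set y : ℕ → Y := fun k => z + t k • uk k with hy_def
    set vk : ℕ → Y := fun k => (t k)⁻¹ •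
      (ContinuousLinearMap.adjoint (fderiv ℝ h (y k)) μ -
        ContinuousLinearMap.adjoint (fderiv ℝ h z) μ) +
      ContinuousLinearMap.adjoint (fderiv ℝ h (y k)) (bk k) with hvk
    have hv : Tendsto vk atTop (𝓝 (curvature h μ z u +
        ContinuousLinearMap.adjoint (fderiv ℝ h z) η)) :=
      (tendsto_differenceQuotient hcurv ht ht0 hu).add
        (tendsto_clm_apply (hJadj.tendsto.comp hy) hb)
    refine mem_tangentCone_of_eventually (show (z, l) ∈ setValuedGraph (normalCone Θ) from hl) ht ht0
      (hu.prodMk_nhds hv) ?_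
    filter_upwards [hlift, hy.eventually hN] with k h1 h2
    show l + t k • vk k ∈ normalCone Θ (y k)
    rw [h2]
    refine ⟨μ + t k • bk k, ?_, ?_⟩
    · rw [h1, hred.map_eq_zero, zero_add]
      exact hab k
    · rw [hvk, hlμ, map_add, map_smul]
      simp only [smul_add, smul_smul, mul_inv_cancel₀ (ht k).ne', one_smul]
      abel

end GeneralFormula

/-! ### Construction of reductions; convex polyhedra -/

section Polyhedra

variable {Y E : Type*} [NormedAddCommGroup Y] [InnerProductSpace ℝ Y]
  [NormedAddCommGroup E] [InnerProductSpace ℝ E]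

/-- Smoothness at the point and a local description of the set provide the neighborhood in the
definition of a cone reduction. -/
theorem exists_reduction_nhds {Θ : Set Y} {C : Set E} {h : Y → E} {z : Y}
    (hh : ContDiffAt ℝ 2 h z) (hΘ : ∀ᶠ y in 𝓝 z, y ∈ Θ ↔ h y ∈ C) :
    ∃ O : Set Y, IsOpen O ∧ z ∈ O ∧ ContDiffOn ℝ 2 h O ∧ Θ ∩ O = {y | y ∈ O ∧ h y ∈ C} := by
  obtain ⟨V, hV, hVo, hzV⟩ := eventually_nhds_iff.1 ((hh.eventually (by simp)).and hΘ)
  refine ⟨V, hVo, hzV, fun y hy => (hV y hy).1.contDiffWithinAt, ?_⟩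
  ext y
  constructor
  · rintro ⟨h1, h2⟩
    exact ⟨h2, (hV y h2).2.1 h1⟩
  · rintro ⟨h1, h2⟩
    exact ⟨(hV y h1).2.2 h2, h1⟩

/-- Affine mappings have no curvature. -/
theorem curvature_eq_zero_of_affine [FiniteDimensional ℝ Y] [FiniteDimensional ℝ E] {h : Y → E}
    {J : Y →L[ℝ] E} (hJ : ∀ y, HasFDerivAt h J y) (μ : E) (z u : Y) : curvature h μ z u = 0 := by
  have : CompleteSpace Y := FiniteDimensional.complete ℝ Y
  have : CompleteSpace E := FiniteDimensional.complete ℝ E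
  have h1 : gradient (fun y => ⟪μ, h y⟫_ℝ) = fun _ => ContinuousLinearMap.adjoint J μ := by
    funext y
    rw [gradient_inner_comp (hJ y).differentiableAt, (hJ y).fderiv]
  show fderiv ℝ (gradient fun y => ⟪μ, h y⟫_ℝ) z u = 0
  rw [h1]
  simp

/-- Near one of its points a polyhedron is given by its active inequalities. -/
theorem eventually_mem_polyhedron_iff {k : ℕ} {a : Fin k → Y} {b : Fin k → ℝ} {z : Y}
    (hz : ∀ i, ⟪a i, z⟫_ℝ ≤ b i) :
    ∀ᶠ y in 𝓝 z, (∀ i, ⟪a i, y⟫_ℝ ≤ b i) ↔ ∀ i, ⟪a i, z⟫_ℝ = b i → ⟪a i, y - z⟫_ℝ ≤ 0 := by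
  have h1 : ∀ᶠ y in 𝓝 z, ∀ i, ⟪a i, z⟫_ℝ ≠ b i → ⟪a i, y⟫_ℝ ≤ b i := by
    refine eventually_all.2 fun i => ?_
    by_cases hi : ⟪a i, z⟫_ℝ = b i
    · exact Eventually.of_forall fun y h => absurd hi h
    · have hc : Continuous fun y => ⟪a i, y⟫_ℝ := by fun_prop
      filter_upwards [(hc.tendsto z).eventually (gt_mem_nhds (lt_of_le_of_ne (hz i) hi))]
        with y hy _ using hy.le
  filter_upwards [h1] with y hy
  refine forall_congr' fun i => ?_
  by_cases hi : ⟪a i, z⟫_ℝ = b i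
  · simp [hi, inner_sub_right]
  · simp [hi, hy i hi]

variable {m s t : ℕ}

/-- The reduction map of a polyhedron is affine: its derivative is `B` at every point. -/
theorem hasFDerivAt_polyReduction
    (A : WithLp 2 (EuclideanSpace ℝ (Fin s) × EuclideanSpace ℝ (Fin t)) ≃ₗᵢ[ℝ]
      EuclideanSpace ℝ (Fin m)) (z y : EuclideanSpace ℝ (Fin m)) :
    HasFDerivAt (polyReduction A z)
      (WithLp.fstL 2 ℝ (EuclideanSpace ℝ (Fin s)) (EuclideanSpace ℝ (Fin t)) ∘L
        (A.symm.toContinuousLinearEquiv : EuclideanSpace ℝ (Fin m) →L[ℝ]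
          WithLp 2 (EuclideanSpace ℝ (Fin s) × EuclideanSpace ℝ (Fin t)))) y :=
  HasFDerivAt.sub_const (A.symm z).fst (ContinuousLinearMap.hasFDerivAt
    (WithLp.fstL 2 ℝ (EuclideanSpace ℝ (Fin s)) (EuclideanSpace ℝ (Fin t)) ∘L
      (A.symm.toContinuousLinearEquiv : EuclideanSpace ℝ (Fin m) →L[ℝ]
        WithLp 2 (EuclideanSpace ℝ (Fin s) × EuclideanSpace ℝ (Fin t)))))

/-- The normals of the active inequalities belong to the normal cone, so the reduction of a
polyhedron keeps every active inequality; the remaining ones are inactive nearby. -/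
theorem isConeReduction_polyReduction {Θ : Set (EuclideanSpace ℝ (Fin m))}
    {z : EuclideanSpace ℝ (Fin m)}
    {A : WithLp 2 (EuclideanSpace ℝ (Fin s) × EuclideanSpace ℝ (Fin t)) ≃ₗᵢ[ℝ]
      EuclideanSpace ℝ (Fin m)}
    (hΘ : IsConvexPolyhedron Θ) (hz : z ∈ Θ)
    (hA : ∀ y, y ∈ Submodule.span ℝ (normalCone Θ z) ↔ (A.symm y).snd = 0) :
    IsConeReduction Θ z (polyCone Θ A z) (polyReduction A z) := by
  obtain ⟨k, a, b, rfl⟩ := hΘ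
  have hact : ∀ i, ⟪a i, z⟫_ℝ = b i → (A.symm (a i)).snd = 0 := by
    intro i hi
    refine (hA _).1 (Submodule.subset_span (regularNormalCone_subset_normalCone _ _ ⟨hz, ?_⟩))
    intro ε hε
    filter_upwards [self_mem_nhdsWithin] with y hy
    have : ⟪a i, y⟫_ℝ ≤ b i := hy i
    rw [inner_sub_right, hi]
    linarith [mul_nonneg hε.le (norm_nonneg (y - z))]
  have hinner : ∀ i, ⟪a i, z⟫_ℝ = b i → ∀ y, ⟪a i, y⟫_ℝ = ⟪(A.symm (a i)).fst, (A.symm y).fst⟫_ℝ := by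
    intro i hi y
    rw [← A.symm.inner_map_map, WithLp.prod_inner_apply, WithLp.ofLp_fst, WithLp.ofLp_fst,
      WithLp.ofLp_snd, hact i hi, inner_zero_left, add_zero]
  have hloc := eventually_mem_polyhedron_iff hz
  have hcone : polyCone {z | ∀ i, ⟪a i, z⟫_ℝ ≤ b i} A z =
      {d | ∀ i, ⟪a i, z⟫_ℝ = b i → ⟪(A.symm (a i)).fst, d⟫_ℝ ≤ 0} := by
    ext d
    constructor
    · rintro ⟨-, τ, w, hτ, -, hw, hmem⟩ i hi
      refine le_of_tendsto (tendsto_const_nhds.inner hw) (Eventually.of_forall fun j => ?_)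
      have h1 : ⟪a i, A (WithLp.toLp 2 ((A.symm z).fst + τ j • w j, (A.symm z).snd))⟫_ℝ ≤ b i :=
        hmem j i
      rw [hinner i hi, A.symm_apply_apply] at h1
      have h1 : ⟪(A.symm (a i)).fst, (A.symm z).fst + τ j • w j⟫_ℝ ≤ b i := h1
      rw [← hi, hinner i hi, inner_add_right, inner_smul_right] at h1
      by_contra! hneg
      have := mul_pos (hτ j) hneg
      linarith
    · intro hd
      have hbase : A (WithLp.toLp 2 ((A.symm z).fst, (A.symm z).snd)) = z := A.apply_symm_apply z
      refine mem_tangentCone_of_eventually (t := fun j => 1 / ((j : ℝ) + 1)) (wk := fun _ => d) ?_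
        (fun j => by positivity) tendsto_one_div_add_atTop_nhds_zero_nat tendsto_const_nhds ?_
      · intro i
        rw [hbase]
        exact hz i
      · set x : ℕ → EuclideanSpace ℝ (Fin m) := fun j =>
          A (WithLp.toLp 2 ((A.symm z).fst + (1 / ((j : ℝ) + 1)) • d, (A.symm z).snd)) with hx
        have hlim : Tendsto x atTop (𝓝 z) := by
          have hc : Continuous fun τ : ℝ =>
              A (WithLp.toLp 2 ((A.symm z).fst + τ • d, (A.symm z).snd)) := by fun_prop
          have := (hc.tendsto 0).comp tendsto_one_div_add_atTop_nhds_zero_nat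
          rwa [zero_smul, add_zero, hbase] at this
        filter_upwards [hlim.eventually hloc] with j hj
        refine hj.2 fun i hi => ?_
        rw [inner_sub_right, hinner i hi, hinner i hi, hx, A.symm_apply_apply]
        show ⟪(A.symm (a i)).fst, (A.symm z).fst + (1 / ((j : ℝ) + 1)) • d⟫_ℝ -
          ⟪(A.symm (a i)).fst, (A.symm z).fst⟫_ℝ ≤ 0
        rw [inner_add_right, add_sub_cancel_left, inner_smul_right]
        exact mul_nonpos_of_nonneg_of_nonpos (by positivity) (hd i hi)
  refine ⟨?_, hz, ?_, exists_reduction_nhds ?_ ?_, by simp [polyReduction], ?_⟩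
  · have : {z | ∀ i, ⟪a i, z⟫_ℝ ≤ b i} = ⋂ i, {z | ⟪a i, z⟫_ℝ ≤ b i} := by ext; simp
    rw [this]
    exact isClosed_iInter fun i => isClosed_le (by fun_prop) continuous_const
  · rw [hcone]
    refine ⟨?_, ?_, ⟨0, fun i _ => by simp⟩, fun τ hτ x hx i hi => ?_⟩
    · have : {d | ∀ i, ⟪a i, z⟫_ℝ = b i → ⟪(A.symm (a i)).fst, d⟫_ℝ ≤ 0} =
          ⋂ i, ⋂ (_ : ⟪a i, z⟫_ℝ = b i), {d | ⟪(A.symm (a i)).fst, d⟫_ℝ ≤ 0} := by ext; simp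
      rw [this]
      exact isClosed_iInter fun i => isClosed_iInter fun _ =>
        isClosed_le (by fun_prop) continuous_const
    · intro x hx y hy α β hα hβ _ i hi
      rw [inner_add_right, inner_smul_right, inner_smul_right]
      exact add_nonpos (mul_nonpos_of_nonneg_of_nonpos hα (hx i hi))
        (mul_nonpos_of_nonneg_of_nonpos hβ (hy i hi))
    · rw [inner_smul_right]
      exact mul_nonpos_of_nonneg_of_nonpos hτ (hx i hi)
  · exact ((ContinuousLinearMap.contDiff
      (WithLp.fstL 2 ℝ (EuclideanSpace ℝ (Fin s)) (EuclideanSpace ℝ (Fin t)) ∘L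
        (A.symm.toContinuousLinearEquiv : EuclideanSpace ℝ (Fin m) →L[ℝ]
          WithLp 2 (EuclideanSpace ℝ (Fin s) × EuclideanSpace ℝ (Fin t))))).sub
        contDiff_const).contDiffAt
  · rw [hcone]
    filter_upwards [hloc] with y hy
    refine hy.trans (forall_congr' fun i => forall_congr' fun hi => ?_)
    rw [inner_sub_right, hinner i hi, hinner i hi, ← inner_sub_right]
    rfl
  · rw [(hasFDerivAt_polyReduction A z z).fderiv]
    intro x
    refine ⟨A (WithLp.toLp 2 (x, 0)), ?_⟩
    show (A.symm (A (WithLp.toLp 2 (x, 0)))).fst = x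
    rw [A.symm_apply_apply]
    rfl

end Polyhedra

/-! ### The second-order cone -/

section SecondOrderCone

variable {n : ℕ}

/-- A shortcut: the general instance search through `WithLp` and `EuclideanSpace` is slow. -/
instance : ContinuousSMul ℝ (LorentzSpace n) :=
  @IsBoundedSMul.continuousSMul ℝ (LorentzSpace n) _ _ _ _ _ _

theorem isClosedConvexCone_secondOrderCone : IsClosedConvexCone (secondOrderCone n) where
  isClosed := isClosed_le (WithLp.fstL 2 ℝ _ _).continuous.norm (WithLp.sndL 2 ℝ _ _).continuous
  convex := by
    intro x hx y hy a b ha hb _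
    have hx : ‖x.fst‖ ≤ x.snd := hx
    have hy : ‖y.fst‖ ≤ y.snd := hy
    show ‖(a • x + b • y).fst‖ ≤ (a • x + b • y).snd
    calc ‖(a • x + b • y).fst‖ = ‖a • x.fst + b • y.fst‖ := rfl
      _ ≤ ‖a • x.fst‖ + ‖b • y.fst‖ := norm_add_le _ _
      _ = a * ‖x.fst‖ + b * ‖y.fst‖ := by
        rw [norm_smul, norm_smul, Real.norm_of_nonneg ha, Real.norm_of_nonneg hb]
      _ ≤ a * x.snd + b * y.snd := by gcongr
      _ = (a • x + b • y).snd := rfl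
  nonempty := ⟨0, by simp [secondOrderCone]⟩
  smul_mem := by
    intro t ht x hx
    have hx : ‖x.fst‖ ≤ x.snd := hx
    show ‖(t • x).fst‖ ≤ (t • x).snd
    calc ‖(t • x).fst‖ = ‖t • x.fst‖ := rfl
      _ = t * ‖x.fst‖ := by rw [norm_smul, Real.norm_of_nonneg ht]
      _ ≤ t * x.snd := by gcongr

theorem norm_fst_eq_snd_of_mem_frontier {z : LorentzSpace n} (hz : z ∈ frontier (secondOrderCone n)) :
    ‖z.fst‖ = z.snd := by
  have hcl := isClosedConvexCone_secondOrderCone (n := n).isClosed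
  have hzQ : ‖z.fst‖ ≤ z.snd := hcl.frontier_subset hz
  refine hzQ.eq_of_not_lt fun hlt => hz.2 ?_
  have hopen : IsOpen {y : LorentzSpace n | ‖y.fst‖ < y.snd} :=
    isOpen_lt (WithLp.fstL 2 ℝ _ _).continuous.norm (WithLp.sndL 2 ℝ _ _).continuous
  have hsub : {y : LorentzSpace n | ‖y.fst‖ < y.snd} ⊆ secondOrderCone n :=
    fun y (hy : ‖y.fst‖ < y.snd) => hy.le
  exact interior_maximal hsub hopen hlt

theorem snd_pos_of_mem_frontier {z : LorentzSpace n} (hz : z ∈ frontier (secondOrderCone n))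
    (hz0 : z ≠ 0) : 0 < z.snd := by
  have h := norm_fst_eq_snd_of_mem_frontier hz
  refine lt_of_le_of_ne (h ▸ norm_nonneg _) fun h0 => hz0 ?_
  rw [← h0, norm_eq_zero] at h
  rw [← norm_eq_zero, ← sq_eq_zero_iff, WithLp.prod_norm_sq_eq_of_L2, h, ← h0]
  simp

theorem isConeReduction_id_secondOrderCone :
    IsConeReduction (secondOrderCone n) 0 (secondOrderCone n) id where
  isClosed := isClosedConvexCone_secondOrderCone.isClosed
  mem := isClosedConvexCone_secondOrderCone.zero_mem
  cone := isClosedConvexCone_secondOrderCone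
  reduces := exists_reduction_nhds contDiffAt_id (Eventually.of_forall fun _ => Iff.rfl)
  map_eq_zero := rfl
  surjective := by
    rw [fderiv_id]
    exact Function.surjective_id

theorem isConeReduction_zero_of_mem_interior {z : LorentzSpace n}
    (hz : z ∈ interior (secondOrderCone n)) :
    IsConeReduction (secondOrderCone n) z {0}
      (fun _ : LorentzSpace n => (0 : EuclideanSpace ℝ (Fin 0))) where
  isClosed := isClosedConvexCone_secondOrderCone.isClosed
  mem := interior_subset hz
  cone := ⟨isClosed_singleton, convex_singleton 0, singleton_nonempty 0,
    fun t _ x _ => Subsingleton.elim _ _⟩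
  reduces := exists_reduction_nhds contDiffAt_const (by
    filter_upwards [mem_interior_iff_mem_nhds.1 hz] with y hy
    simp [hy])
  map_eq_zero := rfl
  surjective := fun x => ⟨0, Subsingleton.elim _ _⟩

/-- The derivative of `‖z_r‖² - z_m²`. -/
noncomputable def socReductionDeriv (y : LorentzSpace n) : LorentzSpace n →L[ℝ] ℝ :=
  (2 : ℝ) • (innerSL ℝ y.fst ∘L WithLp.fstL 2 ℝ _ _) -
    (2 * y.snd) • WithLp.sndL 2 ℝ (EuclideanSpace ℝ (Fin n)) ℝ

theorem socReductionDeriv_apply (y w : LorentzSpace n) :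
    socReductionDeriv y w = 2 * ⟪y.fst, w.fst⟫_ℝ - 2 * y.snd * w.snd := rfl

theorem hasFDerivAt_socReduction (y : LorentzSpace n) :
    HasFDerivAt socReduction (socReductionDeriv y) y := by
  have h1 := (WithLp.fstL 2 ℝ (EuclideanSpace ℝ (Fin n)) ℝ).hasFDerivAt (x := y) |>.norm_sq
  have h2 := (WithLp.sndL 2 ℝ (EuclideanSpace ℝ (Fin n)) ℝ).hasFDerivAt (x := y) |>.pow 2
  refine (h1.sub h2).congr_fderiv ?_
  refine ContinuousLinearMap.ext fun w => ?_
  rw [socReductionDeriv_apply]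
  simp

theorem contDiff_socReduction : ContDiff ℝ 2 (socReduction (n := n)) :=
  ((WithLp.fstL 2 ℝ (EuclideanSpace ℝ (Fin n)) ℝ).contDiff.norm_sq ℝ).sub
    ((WithLp.sndL 2 ℝ (EuclideanSpace ℝ (Fin n)) ℝ).contDiff.pow 2)

theorem isConeReduction_socReduction {z : LorentzSpace n}
    (hz : z ∈ frontier (secondOrderCone n)) (hz0 : z ≠ 0) :
    IsConeReduction (secondOrderCone n) z (Set.Iic (0 : ℝ)) socReduction where
  isClosed := isClosedConvexCone_secondOrderCone.isClosed
  mem := isClosedConvexCone_secondOrderCone.isClosed.frontier_subset hz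
  cone := ⟨isClosed_Iic, convex_Iic 0, nonempty_Iic,
    fun t ht x hx => mul_nonpos_of_nonneg_of_nonpos ht hx⟩
  reduces := exists_reduction_nhds contDiff_socReduction.contDiffAt (by
    have hpos : ∀ᶠ y : LorentzSpace n in 𝓝 z, 0 < y.snd :=
      (WithLp.sndL 2 ℝ (EuclideanSpace ℝ (Fin n)) ℝ).continuous.continuousAt.eventually
        (lt_mem_nhds (snd_pos_of_mem_frontier hz hz0))
    filter_upwards [hpos] with y hy
    show ‖y.fst‖ ≤ y.snd ↔ ‖y.fst‖ ^ 2 - y.snd ^ 2 ≤ 0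
    rw [sub_nonpos, sq_le_sq₀ (norm_nonneg _) hy.le])
  map_eq_zero := by
    rw [socReduction, norm_fst_eq_snd_of_mem_frontier hz, sub_self]
  surjective := by
    have hpos := snd_pos_of_mem_frontier hz hz0
    rw [(hasFDerivAt_socReduction z).fderiv]
    intro r
    refine ⟨WithLp.toLp 2 (0, -r / (2 * z.snd)), ?_⟩
    rw [socReductionDeriv_apply]
    simp only [WithLp.toLp_fst, WithLp.toLp_snd, inner_zero_right]
    field_simp
    ring

theorem curvature_socReduction {z l : LorentzSpace n} (hz : z ∈ frontier (secondOrderCone n))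
    (hz0 : z ≠ 0) {C : Set ℝ} {μ : ℝ} (hμ : IsReducedMultiplier C socReduction z l μ)
    (u : LorentzSpace n) : curvature socReduction μ z u = socCurvature z l u := by
  have hpos := snd_pos_of_mem_frontier hz hz0
  have hl : l.snd = -(2 * μ * z.snd) := by
    have h1 : ⟪l, WithLp.toLp 2 (0, 1)⟫_ℝ = ⟪μ, socReductionDeriv z (WithLp.toLp 2 (0, 1))⟫_ℝ := by
      rw [hμ.1, LinearMap.adjoint_inner_left, (hasFDerivAt_socReduction z).fderiv]
      rfl
    rw [socReductionDeriv_apply, WithLp.prod_inner_apply] at h1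
    simp at h1
    linarith
  refine ext_inner_left ℝ fun w => ?_
  have h1 := hasFDerivAt_inner_fderiv (contDiff_socReduction (n := n)).contDiffAt (z := z) μ w
  have h2 : HasFDerivAt (fun y : LorentzSpace n => ⟪μ, fderiv ℝ socReduction y w⟫_ℝ)
      (μ • socReductionDeriv w) z := by
    refine (μ • socReductionDeriv w).hasFDerivAt.congr_of_eventuallyEq
      (Eventually.of_forall fun y => ?_)
    show ⟪μ, fderiv ℝ socReduction y w⟫_ℝ = _
    rw [(hasFDerivAt_socReduction y).fderiv]
    show socReductionDeriv y w * μ = μ * socReductionDeriv w y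
    rw [socReductionDeriv_apply, socReductionDeriv_apply, real_inner_comm]
    ring
  have h3 := DFunLike.congr_fun (h1.unique h2) u
  rw [socCurvature, if_pos ⟨hz, hz0⟩, hl, inner_smul_right]
  have h4 : ⟪w, curvature socReduction μ z u⟫_ℝ = μ * socReductionDeriv w u := h3
  rw [h4, socReductionDeriv_apply, WithLp.prod_inner_apply]
  have e : -(-(2 * μ * z.snd) / z.snd) = 2 * μ := by field_simp
  rw [e]
  simp
  ring

theorem socCurvature_zero (l u : LorentzSpace n) : socCurvature 0 l u = 0 :=
  if_neg fun h => h.2 rfl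

theorem socCurvature_of_mem_interior {z : LorentzSpace n}
    (hz : z ∈ interior (secondOrderCone n)) (l u : LorentzSpace n) : socCurvature z l u = 0 :=
  if_neg fun h => h.1.2 hz

end SecondOrderCone

/-! ### Smoothness of Gram–Schmidt orthonormalization -/

section GramSchmidt

variable {X V : Type*} [NormedAddCommGroup X] [NormedSpace ℝ X]
  [NormedAddCommGroup V] [InnerProductSpace ℝ V] {k : ℕ}

/-- Gram–Schmidt orthogonalization depends smoothly on linearly independent vectors. -/
theorem contDiffAt_gramSchmidt {n : WithTop ℕ∞} {w : X → Fin k → V} {x₀ : X}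
    (hw : ∀ i, ContDiffAt ℝ n (fun x => w x i) x₀) (hli : LinearIndependent ℝ (w x₀)) (i : Fin k) :
    ContDiffAt ℝ n (fun x => InnerProductSpace.gramSchmidt ℝ (w x) i) x₀ := by
  induction i using WellFoundedLT.induction with
  | ind i ih =>
    have e : (fun x => InnerProductSpace.gramSchmidt ℝ (w x) i) = fun x => w x i -
        ∑ j ∈ Finset.Iio i, (⟪InnerProductSpace.gramSchmidt ℝ (w x) j, w x i⟫_ℝ /
          ‖InnerProductSpace.gramSchmidt ℝ (w x) j‖ ^ 2) •
            InnerProductSpace.gramSchmidt ℝ (w x) j := by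
      funext x
      rw [eq_sub_iff_add_eq]
      exact (InnerProductSpace.gramSchmidt_def'' ℝ (w x) i).symm
    rw [e]
    refine (hw i).sub (ContDiffAt.sum fun j hj => ?_)
    have hj' := ih j (Finset.mem_Iio.1 hj)
    refine ContDiffAt.smul (ContDiffAt.div (hj'.inner ℝ (hw i)) (hj'.norm_sq ℝ) ?_) hj'
    have := InnerProductSpace.gramSchmidt_ne_zero (𝕜 := ℝ) j hli
    positivity

theorem contDiffAt_gramSchmidtNormed {n : WithTop ℕ∞} {w : X → Fin k → V} {x₀ : X}
    (hw : ∀ i, ContDiffAt ℝ n (fun x => w x i) x₀) (hli : LinearIndependent ℝ (w x₀)) (i : Fin k) :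
    ContDiffAt ℝ n (fun x => InnerProductSpace.gramSchmidtNormed ℝ (w x) i) x₀ := by
  have h1 := contDiffAt_gramSchmidt hw hli i
  have h0 := InnerProductSpace.gramSchmidt_ne_zero (𝕜 := ℝ) i hli
  exact ((h1.norm ℝ h0).inv (norm_ne_zero_iff.2 h0)).smul h1

theorem gramSchmidtNormed_of_orthonormal {w : Fin k → V} (hw : Orthonormal ℝ w) :
    InnerProductSpace.gramSchmidtNormed ℝ w = w := by
  funext i
  rw [InnerProductSpace.gramSchmidtNormed,
    InnerProductSpace.gramSchmidt_of_orthogonal ℝ fun i j hij => hw.2 hij]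
  simp [hw.1 i]

end GramSchmidt

/-! ### Perturbation of invariant subspaces -/

section Riccati

variable {R : Type*} [NormedRing R] [NormedAlgebra ℝ R] [CompleteSpace R]

/-- Perturbation of an invariant subspace. Let `z` be block diagonal with respect to the
complementary idempotents `p`, `q`, zero on the block `p` and invertible (with inverse `z'`) on the
block `q`. For `b` near `z` the implicit function theorem solves the Riccati equation that makes
the graph of `x : range p → range q`, that is the range of `p + x`, invariant under `b`. -/
theorem exists_smooth_riccati {p q z z' : R} (hpq : p + q = 1) (hp : p * p = p) (hzp : z * p = 0)
    (hpz : p * z = 0) (hzz' : z * z' = q) (hz'z : z' * z = q) :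
    ∃ x : R → R, ContDiffAt ℝ 2 x z ∧ x z = 0 ∧ ∀ᶠ b in 𝓝 z,
      p * x b = 0 ∧ x b * p = x b ∧ b * (p + x b) = (p + x b) * (p * b * (p + x b)) := by
  have hq : q = 1 - p := eq_sub_of_add_eq' hpq
  have hpq0 : p * q = 0 := by rw [hq, mul_sub, mul_one, hp, sub_self]
  have hqp0 : q * p = 0 := by rw [hq, sub_mul, one_mul, hp, sub_self]
  have hqq : q * q = q := by rw [hq, sub_mul, one_mul, ← hq, hpq0, sub_zero]
  have hqz : q * z = z := by rw [hq, sub_mul, hpz, one_mul, sub_zero]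
  have hzq : z * q = z := by rw [hq, mul_sub, hzp, mul_one, sub_zero]
  -- the Riccati equation for the component `q x p`; the last summand forces `x = q x p`
  let f : R × R → R := fun y => q * y.1 * (p + q * y.2 * p) -
    q * y.2 * p * y.1 * (p + q * y.2 * p) + (y.2 - q * y.2 * p)
  let Lf : R →L[ℝ] R := ContinuousLinearMap.mulLeftRight ℝ R z p +
    (ContinuousLinearMap.id ℝ R - ContinuousLinearMap.mulLeftRight ℝ R q p)
  let Lg : R →L[ℝ] R := ContinuousLinearMap.mulLeftRight ℝ R (q * z' * q) p +
    (ContinuousLinearMap.id ℝ R - ContinuousLinearMap.mulLeftRight ℝ R q p)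
  have hLf : ∀ x, Lf x = z * x * p + (x - q * x * p) := fun x => rfl
  have hLg : ∀ x, Lg x = q * z' * q * x * p + (x - q * x * p) := fun x => rfl
  have qz'q : z * (q * z' * q) = q := by
    rw [← mul_assoc, ← mul_assoc, hzq, hzz', hqq]
  have z'qz : q * z' * q * z = q := by
    rw [mul_assoc, hqz, mul_assoc, hz'z, hqq]
  have hfg : ∀ x, Lf (Lg x) = x := by
    intro x
    rw [hLg, hLf]
    have e1 : z * (q * z' * q * x * p + (x - q * x * p)) * p = q * x * p := by
      have : z * (q * z' * q * x * p + (x - q * x * p)) * p =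
          z * (q * z' * q) * x * (p * p) + (z * x * p - z * q * x * (p * p)) := by noncomm_ring
      rw [this, hp, qz'q, hzq, sub_self, add_zero]
    have e2 : q * (q * z' * q * x * p + (x - q * x * p)) * p = q * z' * q * x * p := by
      have : q * (q * z' * q * x * p + (x - q * x * p)) * p =
          q * q * z' * q * x * (p * p) + (q * x * p - q * q * x * (p * p)) := by noncomm_ring
      rw [this, hp, hqq, sub_self, add_zero]
    rw [e1, e2]
    abel
  have hgf : ∀ x, Lg (Lf x) = x := by
    intro x
    rw [hLg, hLf]
    have e1 : q * z' * q * (z * x * p + (x - q * x * p)) * p = q * x * p := by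
      have : q * z' * q * (z * x * p + (x - q * x * p)) * p =
          q * z' * q * z * x * (p * p) + (q * z' * q * x * p - q * z' * (q * q) * x * (p * p)) := by
        noncomm_ring
      rw [this, hp, z'qz, hqq, sub_self, add_zero]
    have e2 : q * (z * x * p + (x - q * x * p)) * p = z * x * p := by
      have : q * (z * x * p + (x - q * x * p)) * p =
          q * z * x * (p * p) + (q * x * p - q * q * x * (p * p)) := by noncomm_ring
      rw [this, hp, hqq, hqz, sub_self, add_zero]
    rw [e1, e2]
    abel
  -- on the slice `b = z` the Riccati map is linear
  have hfz : ∀ x, f (z, x) = Lf x := by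
    intro x
    rw [hLf]
    show q * z * (p + q * x * p) - q * x * p * z * (p + q * x * p) + (x - q * x * p) = _
    rw [mul_assoc (q * x) p z, hpz, hqz, mul_add, hzp, ← mul_assoc, ← mul_assoc, hzq]
    noncomm_ring
  have hf : ContDiff ℝ 2 f := by
    dsimp only [f]
    fun_prop
  have hder : fderiv ℝ f (z, 0) ∘L ContinuousLinearMap.inr ℝ R R = Lf := by
    have h1 : HasFDerivAt (fun x : R => f (z, x))
        (fderiv ℝ f (z, 0) ∘L ContinuousLinearMap.inr ℝ R R) 0 :=
      HasFDerivAt.comp (f := fun x : R => (z, x)) (0 : R)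
        (hf.differentiable (by norm_num) (z, 0)).hasFDerivAt (hasFDerivAt_prodMk_right _ _)
    have h2 : HasFDerivAt (fun x : R => f (z, x)) Lf 0 := by
      rw [funext hfz]
      exact Lf.hasFDerivAt
    exact h1.unique h2
  have hinv : (fderiv ℝ f (z, 0) ∘L ContinuousLinearMap.inr ℝ R R).IsInvertible := by
    rw [hder]
    exact ⟨ContinuousLinearEquiv.equivOfInverse Lf Lg hgf hfg, rfl⟩
  have hcd : ContDiffAt ℝ 2 f (z, 0) := hf.contDiffAt
  refine ⟨hcd.implicitFunction two_ne_zero hinv, hcd.contDiffAt_implicitFunction two_ne_zero hinv,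
    hcd.implicitFunction_apply_self two_ne_zero hinv, ?_⟩
  filter_upwards [hcd.eventually_apply_implicitFunction two_ne_zero hinv] with b hb
  set x := hcd.implicitFunction two_ne_zero hinv b
  have hb0 : f (b, x) = 0 := by
    rw [hb, hfz, map_zero]
  have hb1 : q * b * (p + q * x * p) - q * x * p * b * (p + q * x * p) + (x - q * x * p) = 0 := hb0
  have hx : x = q * x * p := by
    have h1 : q * (q * b * (p + q * x * p) - q * x * p * b * (p + q * x * p) +
        (x - q * x * p)) * p = 0 := by rw [hb1, mul_zero, zero_mul]
    have h2 : q * (q * b * (p + q * x * p) - q * x * p * b * (p + q * x * p) +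
        (x - q * x * p)) * p = q * b * (p + q * x * p) - q * x * p * b * (p + q * x * p) := by
      have : q * (q * b * (p + q * x * p) - q * x * p * b * (p + q * x * p) +
          (x - q * x * p)) * p = (q * q) * b * (p * p + q * x * (p * p)) -
            (q * q) * x * p * b * (p * p + q * x * (p * p)) + (q * x * p - (q * q) * x * (p * p)) := by
        noncomm_ring
      rw [this, hp, hqq, sub_self, add_zero]
    rw [h2] at h1
    rw [h1, zero_add] at hb1
    exact sub_eq_zero.1 hb1
  have hxp : x * p = x := by rw [hx, mul_assoc, hp]
  refine ⟨by rw [hx, ← mul_assoc, ← mul_assoc, hpq0, zero_mul, zero_mul], hxp, ?_⟩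
  rw [← hx, sub_self, add_zero, sub_eq_zero] at hb1
  calc b * (p + x) = (p + q) * b * (p + x) := by rw [hpq, one_mul]
    _ = p * b * (p + x) + q * b * (p + x) := by rw [add_mul, add_mul]
    _ = (p * p) * b * (p + x) + x * p * b * (p + x) := by rw [hb1, hp, hxp]
    _ = (p + x) * (p * b * (p + x)) := by noncomm_ring

end Riccati

/-! ### The lowest eigenspaces -/

section LowEigenspace

variable {V : Type*} [NormedAddCommGroup V] [InnerProductSpace ℝ V] [FiniteDimensional ℝ V]

/-- An invariant subspace `R` of dimension `k` on which the quadratic form of `T` lies below its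
values on `Rᗮ` is the sum of the eigenspaces for the `k` smallest eigenvalues. -/
theorem iSup_lowest_eigenspaces_eq {T : V →ₗ[ℝ] V} (hT : T.IsSymmetric) {R : Submodule ℝ V}
    (hR : ∀ x ∈ R, T x ∈ R) {a b : ℝ} (hab : a < b) (hlow : ∀ x ∈ R, ⟪T x, x⟫_ℝ ≤ a * ‖x‖ ^ 2)
    (hhigh : ∀ x ∈ Rᗮ, b * ‖x‖ ^ 2 ≤ ⟪T x, x⟫_ℝ) :
    (⨆ (ν : ℝ) (_ : Module.finrank ℝ (⨆ (ν' : ℝ) (_ : ν' < ν), Module.End.eigenspace T ν' :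
        Submodule ℝ V) < Module.finrank ℝ R), Module.End.eigenspace T ν) = R := by
  have hproj : ∀ ν, ∀ x ∈ Module.End.eigenspace T ν,
      T (R.starProjection x) = ν • R.starProjection x ∧
      T (x - R.starProjection x) = ν • (x - R.starProjection x) := by
    intro ν x hx
    have hx : T x = ν • x := Module.End.mem_eigenspace_iff.1 hx
    have h1 : T (R.starProjection x) ∈ R := hR _ (R.starProjection_apply_mem x)
    have h2 : T (x - R.starProjection x) ∈ Rᗮ := by
      rw [Submodule.mem_orthogonal]
      intro y hy
      rw [← hT y]
      exact (Submodule.mem_orthogonal R _).1 (R.sub_starProjection_mem_orthogonal x) _ (hR y hy)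
    have h3 : T (R.starProjection x) - ν • R.starProjection x =
        -(T (x - R.starProjection x) - ν • (x - R.starProjection x)) := by
      rw [map_sub, hx, smul_sub]
      abel
    have h4 : T (R.starProjection x) - ν • R.starProjection x ∈ R :=
      R.sub_mem h1 (R.smul_mem _ (R.starProjection_apply_mem x))
    have h5 : T (R.starProjection x) - ν • R.starProjection x ∈ Rᗮ := by
      rw [h3]
      exact Rᗮ.neg_mem (Rᗮ.sub_mem h2 (Rᗮ.smul_mem _ (R.sub_starProjection_mem_orthogonal x)))
    have h6 : T (R.starProjection x) - ν • R.starProjection x = 0 :=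
      (Submodule.mem_bot ℝ).1 (R.inf_orthogonal_eq_bot ▸ Submodule.mem_inf.2 ⟨h4, h5⟩)
    refine ⟨sub_eq_zero.1 h6, sub_eq_zero.1 ?_⟩
    rw [h6, zero_eq_neg] at h3
    exact h3
  have hsmall : ∀ ν, ν < b → Module.End.eigenspace T ν ≤ R := by
    intro ν hν x hx
    have h1 := hhigh _ (R.sub_starProjection_mem_orthogonal x)
    rw [(hproj ν x hx).2, inner_smul_left, real_inner_self_eq_norm_sq, conj_trivial] at h1
    have h2 : x - R.starProjection x = 0 := by
      rw [← norm_eq_zero, ← sq_eq_zero_iff]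
      nlinarith [sq_nonneg ‖x - R.starProjection x‖]
    rw [sub_eq_zero.1 h2]
    exact R.starProjection_apply_mem x
  have hlarge : ∀ ν, a < ν → ∀ x ∈ Module.End.eigenspace T ν, R.starProjection x = 0 := by
    intro ν hν x hx
    have h1 := hlow _ (R.starProjection_apply_mem x)
    rw [(hproj ν x hx).1, inner_smul_left, real_inner_self_eq_norm_sq, conj_trivial] at h1
    rw [← norm_eq_zero, ← sq_eq_zero_iff]
    nlinarith [sq_nonneg ‖R.starProjection x‖]
  have hgen : R ≤ ⨆ (ν : ℝ) (_ : ν ≤ a), Module.End.eigenspace T ν := by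
    intro x hx
    have htop : x ∈ ⨆ ν : ℝ, Module.End.eigenspace T ν := by
      rw [(Submodule.orthogonal_eq_bot_iff (K := ⨆ ν : ℝ, Module.End.eigenspace T ν)).1
        hT.orthogonalComplement_iSup_eigenspaces_eq_bot]
      exact Submodule.mem_top
    have key : R.starProjection x ∈ ⨆ (ν : ℝ) (_ : ν ≤ a), Module.End.eigenspace T ν := by
      refine Submodule.iSup_induction (fun ν : ℝ => Module.End.eigenspace T ν)
        (motive := fun y => R.starProjection y ∈ ⨆ (ν : ℝ) (_ : ν ≤ a), Module.End.eigenspace T ν)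
        htop ?_ (by simp) (fun y y' h h' => by rw [map_add]; exact Submodule.add_mem _ h h')
      intro ν y hy
      rcases le_or_gt ν a with h | h
      · exact Submodule.mem_iSup_of_mem ν (Submodule.mem_iSup_of_mem h
          (Module.End.mem_eigenspace_iff.2 (hproj ν y hy).1))
      · rw [hlarge ν h y hy]
        exact Submodule.zero_mem _
    rwa [Submodule.starProjection_eq_self_iff.2 hx] at key
  refine le_antisymm (iSup₂_le fun ν hν => ?_) (hgen.trans (iSup₂_le fun ν hν => ?_))
  · rcases le_or_gt ν a with h | h
    · exact hsmall ν (h.trans_lt hab)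
    · refine absurd (Submodule.finrank_mono (hgen.trans ?_)) (not_le.2 hν)
      exact iSup₂_le fun ν' hν' => le_iSup₂_of_le ν' (hν'.trans_lt h) le_rfl
  · by_cases hbot : Module.End.eigenspace T ν = ⊥
    · rw [hbot]
      exact bot_le
    · refine le_iSup₂_of_le ν (Submodule.finrank_lt_finrank_of_lt (lt_of_le_of_ne ?_ ?_)) le_rfl
      · exact iSup₂_le fun ν' hν' => hsmall ν' ((hν'.trans_le hν).trans hab)
      · intro heq
        -- the eigenspace lies in `R` but is orthogonal to the smaller ones
        obtain ⟨x, hx, hx0⟩ := (Submodule.ne_bot_iff _).1 hbot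
        have hxR : x ∈ ⨆ (ν' : ℝ) (_ : ν' < ν), Module.End.eigenspace T ν' := by
          rw [heq]
          exact hsmall ν (hν.trans_lt hab) hx
        have hperp : (⨆ (ν' : ℝ) (_ : ν' < ν), Module.End.eigenspace T ν') ≤
            (Submodule.span ℝ {x})ᗮ := by
          refine iSup₂_le fun ν' hν' y hy => Submodule.mem_orthogonal_singleton_iff_inner_right.2 ?_
          have h1 := hT x y
          rw [Module.End.mem_eigenspace_iff.1 hx, Module.End.mem_eigenspace_iff.1 hy,
            inner_smul_left, inner_smul_right, conj_trivial] at h1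
          have h2 : (ν - ν') * ⟪x, y⟫_ℝ = 0 := by linarith
          exact (mul_eq_zero.1 h2).resolve_left (sub_ne_zero.2 hν'.ne')
        exact hx0 (inner_self_eq_zero.1
          (Submodule.mem_orthogonal_singleton_iff_inner_right.1 (hperp hxR)))

end LowEigenspace

/-! ### Smooth invariant subspaces near a positive semidefinite operator -/

section InvariantFrame

variable {V : Type*} [NormedAddCommGroup V] [InnerProductSpace ℝ V] [FiniteDimensional ℝ V] {k : ℕ}

/-- The kernel of an operator with complement `1 - P` on which it is invertible extends to a smooth
family of invariant subspaces, here described by orthonormal bases. -/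
theorem exists_smooth_invariant_frame {Z Z' P : V →L[ℝ] V} (hP : P * P = P) (hZP : Z * P = 0)
    (hPZ : P * Z = 0) (hZZ' : Z * Z' = 1 - P) (hZ'Z : Z' * Z = 1 - P) {e : Fin k → V}
    (he : Orthonormal ℝ e) (hPe : ∀ i, P (e i) = e i)
    (hPspan : ∀ x, P x ∈ Submodule.span ℝ (range e)) :
    ∃ v : (V →L[ℝ] V) → Fin k → V, (∀ i, ContDiffAt ℝ 2 (fun B => v B i) Z) ∧ v Z = e ∧
      ∀ᶠ B in 𝓝 Z, Orthonormal ℝ (v B) ∧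
        ∀ x ∈ Submodule.span ℝ (range (v B)), B x ∈ Submodule.span ℝ (range (v B)) := by
  have : CompleteSpace V := FiniteDimensional.complete ℝ V
  obtain ⟨X, hX, hXZ, hXB⟩ := exists_smooth_riccati (add_sub_cancel P 1) hP hZP hPZ hZZ' hZ'Z
  have h0 : (fun i => (P + X Z) (e i)) = e := by
    funext i
    rw [hXZ, add_zero, hPe]
  refine ⟨fun B => InnerProductSpace.gramSchmidtNormed ℝ fun i => (P + X B) (e i), ?_, ?_, ?_⟩
  · refine contDiffAt_gramSchmidtNormed (w := fun B i => (P + X B) (e i)) (fun i => ?_) ?_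
    · exact (contDiffAt_const.add hX).clm_apply contDiffAt_const
    · show LinearIndependent ℝ fun i => (P + X Z) (e i)
      rw [h0]
      exact he.linearIndependent
  · show InnerProductSpace.gramSchmidtNormed ℝ (fun i => (P + X Z) (e i)) = e
    rw [h0, gramSchmidtNormed_of_orthonormal he]
  · filter_upwards [hXB] with B ⟨h1, h2, h3⟩
    set M := P + X B with hM
    have hMP : M * P = M := by rw [hM, add_mul, hP, h2]
    have hPM : P * M = P := by rw [hM, mul_add, hP, h1, add_zero]
    have hli : LinearIndependent ℝ fun i => M (e i) := by
      refine LinearIndependent.of_comp (P : V →ₗ[ℝ] V) ?_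
      have : (P : V →ₗ[ℝ] V) ∘ (fun i => M (e i)) = e := by
        funext i
        exact (DFunLike.congr_fun hPM (e i)).trans (hPe i)
      rw [this]
      exact he.linearIndependent
    have hspan : Submodule.span ℝ (range (InnerProductSpace.gramSchmidtNormed ℝ
        fun i => M (e i))) = (Submodule.span ℝ (range e)).map (M : V →ₗ[ℝ] V) := by
      rw [InnerProductSpace.span_gramSchmidtNormed_range, InnerProductSpace.span_gramSchmidt,
        Submodule.map_span, ← range_comp]
      rfl
    refine ⟨InnerProductSpace.gramSchmidtNormed_orthonormal hli, ?_⟩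
    rw [hspan]
    rintro _ ⟨x, -, rfl⟩
    refine ⟨P (B (M x)), hPspan _, ?_⟩
    exact (DFunLike.congr_fun h3 x).symm

/-- The orthogonal projection onto the span of an orthonormal family. -/
theorem starProjection_span_range {v : Fin k → V} (hv : Orthonormal ℝ v) (x : V) :
    (Submodule.span ℝ (range v)).starProjection x = ∑ j, ⟪v j, x⟫_ℝ • v j := by
  refine (Submodule.eq_starProjection_of_mem_of_inner_eq_zero ?_ ?_)
  · exact Submodule.sum_mem _ fun j _ =>
      Submodule.smul_mem _ _ (Submodule.subset_span (mem_range_self j))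
  · intro w hw
    induction hw using Submodule.span_induction with
    | mem w hw =>
      obtain ⟨i, rfl⟩ := hw
      rw [inner_sub_left, sum_inner, Finset.sum_eq_single i]
      · rw [inner_smul_left, real_inner_self_eq_norm_sq, hv.1 i, conj_trivial, real_inner_comm]
        ring
      · intro j _ hji
        rw [inner_smul_left, hv.2 hji, mul_zero]
      · simp
    | zero => simp
    | add a b _ _ ha hb => rw [inner_add_right, ha, hb, add_zero]
    | smul c a _ ha => rw [inner_smul_right, ha, mul_zero]

/-- A self-adjoint operator close to one that vanishes on the span of an orthonormal family and is
at least `c` on its orthogonal complement has separated numerical ranges. -/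
theorem eventually_separated {S : Type*} [TopologicalSpace S] {s₀ : S} {T : S → V →L[ℝ] V}
    (hT : ContinuousAt T s₀) {v : S → Fin k → V} (hv : ∀ i, ContinuousAt (fun s => v s i) s₀)
    (hT0 : ∀ i, T s₀ (v s₀ i) = 0)
    {c : ℝ} (hc : 0 < c)
    (hpos : ∀ x, c * ‖x‖ ^ 2 ≤ ⟪T s₀ x, x⟫_ℝ + ∑ j, ⟪v s₀ j, x⟫_ℝ ^ 2) :
    ∀ᶠ s in 𝓝 s₀, Orthonormal ℝ (v s) →
      (∀ x ∈ Submodule.span ℝ (range (v s)), ⟪T s x, x⟫_ℝ ≤ c / 4 * ‖x‖ ^ 2) ∧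
      ∀ x ∈ (Submodule.span ℝ (range (v s)))ᗮ, c / 2 * ‖x‖ ^ 2 ≤ ⟪T s x, x⟫_ℝ := by
  let Q : S → V →L[ℝ] V := fun s => ∑ j, (innerSL ℝ (v s j)).smulRight (v s j)
  have hQ_apply : ∀ s x, Q s x = ∑ j, ⟪v s j, x⟫_ℝ • v s j := fun s x => by
    simp [Q]
  have hQ : ContinuousAt Q s₀ := by
    refine tendsto_finsetSum _ fun j _ => ?_
    have h : ContinuousAt (fun s => ContinuousLinearMap.smulRightL ℝ V V (innerSL ℝ (v s j)) (v s j))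
        s₀ := by
      refine ContinuousAt.clm_apply ?_ (hv j)
      exact (ContinuousLinearMap.smulRightL ℝ V V).continuous.continuousAt.comp
        ((innerSL ℝ).continuous.continuousAt.comp (hv j))
    exact h
  have h1 : ContinuousAt (fun s => ‖T s * Q s‖) s₀ := (hT.mul hQ).norm
  have h2 : ContinuousAt (fun s => ‖(T s + Q s) - (T s₀ + Q s₀)‖) s₀ :=
    ((hT.add (hQ)).sub continuousAt_const).norm
  have h10 : ‖T s₀ * Q s₀‖ < c / 4 := by
    have : T s₀ * Q s₀ = 0 := by
      refine ContinuousLinearMap.ext fun x => ?_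
      show T s₀ (Q s₀ x) = 0
      simp [hQ_apply, map_sum, hT0]
    rw [this, norm_zero]
    positivity
  have h20 : ‖(T s₀ + Q s₀) - (T s₀ + Q s₀)‖ < c / 2 := by
    rw [sub_self, norm_zero]
    positivity
  filter_upwards [h1.eventually (gt_mem_nhds h10), h2.eventually (gt_mem_nhds h20)] with s hs1 hs2 hvs
  constructor
  · intro x hx
    have hQx : Q s x = x := by
      rw [hQ_apply, ← starProjection_span_range hvs, Submodule.starProjection_eq_self_iff.2 hx]
    calc ⟪T s x, x⟫_ℝ = ⟪(T s * Q s) x, x⟫_ℝ := by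
          rw [mul_apply_eq_comp, hQx]
      _ ≤ ‖(T s * Q s) x‖ * ‖x‖ := real_inner_le_norm _ _
      _ ≤ ‖T s * Q s‖ * ‖x‖ * ‖x‖ := by gcongr; exact (T s * Q s).le_opNorm x
      _ ≤ c / 4 * ‖x‖ * ‖x‖ := by gcongr
      _ = c / 4 * ‖x‖ ^ 2 := by ring
  · intro x hx
    have hQx : Q s x = 0 := by
      rw [hQ_apply]
      refine Finset.sum_eq_zero fun j _ => ?_
      rw [(Submodule.mem_orthogonal _ _).1 hx _ (Submodule.subset_span (mem_range_self j)), zero_smul]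
    set D := (T s + Q s) - (T s₀ + Q s₀) with hD
    have e : T s x = (T s₀ x + Q s₀ x) + D x := by
      have : D x = T s x + Q s x - (T s₀ x + Q s₀ x) := rfl
      rw [this, hQx]
      abel
    have h3 : ⟪Q s₀ x, x⟫_ℝ = ∑ j, ⟪v s₀ j, x⟫_ℝ ^ 2 := by
      rw [hQ_apply, sum_inner]
      refine Finset.sum_congr rfl fun j _ => ?_
      rw [inner_smul_left, conj_trivial, sq]
    have h4 : -(c / 2 * ‖x‖ ^ 2) ≤ ⟪D x, x⟫_ℝ := by
      refine neg_le_of_abs_le ((abs_real_inner_le_norm _ _).trans ?_)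
      calc ‖D x‖ * ‖x‖ ≤ ‖D‖ * ‖x‖ * ‖x‖ := by gcongr; exact D.le_opNorm x
        _ ≤ c / 2 * ‖x‖ * ‖x‖ := by gcongr
        _ = c / 2 * ‖x‖ ^ 2 := by ring
    have h5 := hpos x
    rw [e, inner_add_left, inner_add_left, h3]
    linarith

/-- A positive semidefinite operator with kernel spanned by `e` is bounded below on the orthogonal
complement of its kernel. -/
theorem exists_pos_lower_bound {T : V →L[ℝ] V} (hT : ∀ x, 0 ≤ ⟪T x, x⟫_ℝ) {e : Fin k → V}
    (he : Orthonormal ℝ e) (hker : ∀ x, ⟪T x, x⟫_ℝ = 0 → x ∈ Submodule.span ℝ (range e)) :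
    ∃ c : ℝ, 0 < c ∧ ∀ x, c * ‖x‖ ^ 2 ≤ ⟪T x, x⟫_ℝ + ∑ j, ⟪e j, x⟫_ℝ ^ 2 := by
  set q : V → ℝ := fun x => ⟪T x, x⟫_ℝ + ∑ j, ⟪e j, x⟫_ℝ ^ 2 with hq
  have hqc : Continuous q := by fun_prop
  have hqpos : ∀ x, x ≠ 0 → 0 < q x := by
    intro x hx
    have h1 : 0 ≤ ∑ j, ⟪e j, x⟫_ℝ ^ 2 := Finset.sum_nonneg fun j _ => sq_nonneg _
    refine lt_of_le_of_ne (add_nonneg (hT x) h1) fun h => hx ?_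
    have h2 : ⟪T x, x⟫_ℝ = 0 := by linarith [hT x]
    have h3 : ∑ j, ⟪e j, x⟫_ℝ ^ 2 = 0 := by linarith [hT x]
    rw [Finset.sum_eq_zero_iff_of_nonneg fun j _ => sq_nonneg _] at h3
    rw [← Submodule.starProjection_eq_self_iff.2 (hker x h2), starProjection_span_range he]
    refine Finset.sum_eq_zero fun j hj => ?_
    rw [sq_eq_zero_iff.1 (h3 j hj), zero_smul]
  rcases (Metric.sphere (0 : V) 1).eq_empty_or_nonempty with hemp | hne
  · refine ⟨1, one_pos, fun x => ?_⟩
    by_cases hx : x = 0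
    · simp [hx]
    · have : ‖x‖⁻¹ • x ∈ Metric.sphere (0 : V) 1 := by
        rw [mem_sphere_zero_iff_norm, norm_smul, norm_inv, norm_norm,
          inv_mul_cancel₀ (norm_ne_zero_iff.2 hx)]
      rw [hemp] at this
      exact absurd this (notMem_empty _)
  · obtain ⟨y, hy, hmin⟩ := (isCompact_sphere (0 : V) 1).exists_isMinOn hne hqc.continuousOn
    have hy0 : y ≠ 0 := by
      rintro rfl
      simp at hy
    refine ⟨q y, hqpos y hy0, fun x => ?_⟩
    by_cases hx : x = 0
    · simp [hx]
    · have hxn : ‖x‖ ≠ 0 := norm_ne_zero_iff.2 hx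
      have h1 : ‖x‖⁻¹ • x ∈ Metric.sphere (0 : V) 1 := by
        rw [mem_sphere_zero_iff_norm, norm_smul, norm_inv, norm_norm, inv_mul_cancel₀ hxn]
      have h2 : q y ≤ q (‖x‖⁻¹ • x) := hmin h1
      have h3 : q (‖x‖⁻¹ • x) = (‖x‖ ^ 2)⁻¹ * q x := by
        simp only [hq, map_smul, inner_smul_left, inner_smul_right, conj_trivial, mul_pow, mul_add,
          Finset.mul_sum]
        congr 1
        · ring
        · exact Finset.sum_congr rfl fun j _ => by ring
      rw [h3, inv_mul_eq_div, le_div_iff₀ (by positivity)] at h2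
      exact h2

end InvariantFrame

/-! ### Symmetric matrices and pseudo-inverses -/

section SymmetricMatrices

variable {m k : ℕ}

/-- The operator on `ℝ^m` given by a symmetric matrix. -/
noncomputable def SymMat.toCLM : SymMat m →L[ℝ]
    (EuclideanSpace ℝ (Fin m) →L[ℝ] EuclideanSpace ℝ (Fin m)) :=
  LinearMap.toContinuousLinearMap
    { toFun := fun A => Matrix.toEuclideanCLM (𝕜 := ℝ) A.toMatrix
      map_add' := fun A B => by
        rw [← map_add]
        rfl
      map_smul' := fun c A => by
        rw [RingHom.id_apply, ← map_smul]
        rfl }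

theorem SymMat.toCLM_eq (A : SymMat m) :
    SymMat.toCLM A = Matrix.toEuclideanCLM (𝕜 := ℝ) A.toMatrix := rfl

/-- The transpose is the adjoint. -/
theorem inner_toEuclideanCLM_transpose (A : Matrix (Fin m) (Fin m) ℝ)
    (x y : EuclideanSpace ℝ (Fin m)) :
    ⟪Matrix.toEuclideanCLM (𝕜 := ℝ) A.transpose x, y⟫_ℝ =
      ⟪x, Matrix.toEuclideanCLM (𝕜 := ℝ) A y⟫_ℝ := by
  rw [real_inner_comm, Matrix.inner_toEuclideanCLM, Matrix.inner_toEuclideanCLM,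
    Matrix.mulVec_transpose, Matrix.dotProduct_mulVec, dotProduct_comm]

theorem inner_toEuclideanCLM_comm {A : Matrix (Fin m) (Fin m) ℝ} (hA : A.IsSymm)
    (x y : EuclideanSpace ℝ (Fin m)) :
    ⟪Matrix.toEuclideanCLM (𝕜 := ℝ) A x, y⟫_ℝ = ⟪x, Matrix.toEuclideanCLM (𝕜 := ℝ) A y⟫_ℝ := by
  have := inner_toEuclideanCLM_transpose A x y
  rwa [hA] at this

theorem SymMat.toCLM_symmetric (A : SymMat m) (x y : EuclideanSpace ℝ (Fin m)) :
    ⟪SymMat.toCLM A x, y⟫_ℝ = ⟪x, SymMat.toCLM A y⟫_ℝ :=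
  inner_toEuclideanCLM_comm A.isSymm x y

theorem mem_psdCone_iff (A : SymMat m) : A ∈ psdCone m ↔ ∀ x, 0 ≤ ⟪SymMat.toCLM A x, x⟫_ℝ := by
  show A.toMatrix.PosSemidef ↔ _
  rw [Matrix.posSemidef_iff_dotProduct_mulVec, and_iff_right]
  · constructor
    · intro h x
      rw [SymMat.toCLM_symmetric, SymMat.toCLM_eq, Matrix.inner_toEuclideanCLM]
      exact h x
    · intro h x
      have := h (WithLp.toLp 2 x)
      rwa [SymMat.toCLM_symmetric, SymMat.toCLM_eq, Matrix.inner_toEuclideanCLM] at this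
  · rw [Matrix.IsHermitian, Matrix.conjTranspose_eq_transpose_of_trivial]
    exact A.isSymm

theorem toCLM_eq_zero_of_mem_psdCone {A : SymMat m} (hA : A ∈ psdCone m)
    {x : EuclideanSpace ℝ (Fin m)} (hx : ⟪SymMat.toCLM A x, x⟫_ℝ = 0) : SymMat.toCLM A x = 0 := by
  have hA : A.toMatrix.PosSemidef := hA
  rw [SymMat.toCLM_symmetric, SymMat.toCLM_eq, Matrix.inner_toEuclideanCLM] at hx
  have h := (hA.dotProduct_mulVec_zero_iff x.ofLp).1 hx
  rw [SymMat.toCLM_eq]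
  ext i
  exact congrFun h i

/-- The matrix entries of a symmetric matrix. -/
noncomputable def SymMat.entry (i j : Fin m) : SymMat m →L[ℝ] ℝ :=
  (EuclideanSpace.proj (i, j)).comp (symmetricSubmodule m).subtypeL

theorem SymMat.inner_eq_sum (A B : SymMat m) :
    ⟪A, B⟫_ℝ = ∑ i, ∑ j, A.toMatrix i j * B.toMatrix i j := by
  rw [Submodule.coe_inner, PiLp.inner_apply, Fintype.sum_prod_type]
  refine Finset.sum_congr rfl fun i _ => Finset.sum_congr rfl fun j _ => ?_
  exact mul_comm _ _

theorem contDiffAt_symMat {X : Type*} [NormedAddCommGroup X] [NormedSpace ℝ X] {n : WithTop ℕ∞}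
    {f : X → SymMat m} {x : X} (hf : ∀ i j, ContDiffAt ℝ n (fun y => (f y).toMatrix i j) x) :
    ContDiffAt ℝ n f x := by
  have h1 : ContDiffAt ℝ n (fun y => (f y : EuclideanSpace ℝ (Fin m × Fin m))) x := by
    rw [contDiffAt_euclidean]
    exact fun p => hf p.1 p.2
  have h2 := ((symmetricSubmodule m).orthogonalProjectionOnto.contDiff (n := n)).contDiffAt.comp x h1
  refine h2.congr_of_eventuallyEq (Eventually.of_forall fun y => ?_)
  simp

theorem isClosedConvexCone_psdCone : IsClosedConvexCone (psdCone m) := by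
  have h : psdCone m = ⋂ x, {A | 0 ≤ ⟪SymMat.toCLM A x, x⟫_ℝ} := by
    ext A
    simp [mem_psdCone_iff]
  refine ⟨?_, ?_, ⟨0, ?_⟩, ?_⟩
  · rw [h]
    refine isClosed_iInter fun x => isClosed_le continuous_const ?_
    exact (SymMat.toCLM.continuous.clm_apply continuous_const).inner continuous_const
  · intro A hA B hB a b ha hb _
    rw [mem_psdCone_iff] at *
    intro x
    rw [map_add, map_smul, map_smul, add_apply, smul_apply, smul_apply, inner_add_left,
      inner_smul_left, inner_smul_left]
    exact add_nonneg (mul_nonneg ha (hA x)) (mul_nonneg hb (hB x))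
  · rw [mem_psdCone_iff]
    simp
  · intro t ht A hA
    rw [mem_psdCone_iff] at *
    intro x
    rw [map_smul, smul_apply, inner_smul_left]
    exact mul_nonneg ht (hA x)

theorem pinv_isSymm {A : Matrix (Fin m) (Fin m) ℝ} (hA : A.IsSymm) : (pinv A).IsSymm := by
  have h := isMoorePenrose_pinv hA
  refine IsMoorePenrose.unique (A := A) ⟨?_, ?_, ?_, ?_⟩ h
  · have := congrArg Matrix.transpose h.1
    rwa [Matrix.transpose_mul, Matrix.transpose_mul, hA, ← mul_assoc] at this
  · have := congrArg Matrix.transpose h.2.1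
    rwa [Matrix.transpose_mul, Matrix.transpose_mul, hA, ← mul_assoc] at this
  · have := h.2.2.2
    rw [Matrix.IsSymm, Matrix.transpose_mul, hA] at this
    rw [this]
    exact h.2.2.2
  · have := h.2.2.1
    rw [Matrix.IsSymm, Matrix.transpose_mul, hA] at this
    rw [this]
    exact h.2.2.1

/-- `A†A` is the orthogonal projection onto the orthogonal complement of the kernel. -/
theorem pinv_mul_self {A : Matrix (Fin m) (Fin m) ℝ} (hA : A.IsSymm) :
    Matrix.toEuclideanCLM (𝕜 := ℝ) (pinv A) * Matrix.toEuclideanCLM (𝕜 := ℝ) A =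
      1 - (LinearMap.ker (Matrix.toEuclideanLin A)).starProjection := by
  have h := isMoorePenrose_pinv hA
  refine ContinuousLinearMap.ext fun x => ?_
  have h1 : Matrix.toEuclideanCLM (𝕜 := ℝ) A
      (Matrix.toEuclideanCLM (𝕜 := ℝ) (pinv A) (Matrix.toEuclideanCLM (𝕜 := ℝ) A x)) =
      Matrix.toEuclideanCLM (𝕜 := ℝ) A x := by
    have := congrArg (fun M => Matrix.toEuclideanCLM (𝕜 := ℝ) M x) h.1
    simpa [map_mul] using this
  have h2 : (LinearMap.ker (Matrix.toEuclideanLin A)).starProjection x = x -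
      Matrix.toEuclideanCLM (𝕜 := ℝ) (pinv A) (Matrix.toEuclideanCLM (𝕜 := ℝ) A x) := by
    refine Submodule.eq_starProjection_of_mem_of_inner_eq_zero ?_ ?_
    · rw [LinearMap.mem_ker]
      show Matrix.toEuclideanCLM (𝕜 := ℝ) A _ = 0
      rw [map_sub, h1, sub_self]
    · intro w hw
      have hw : Matrix.toEuclideanCLM (𝕜 := ℝ) A w = 0 := hw
      have h3 := inner_toEuclideanCLM_comm h.2.2.2 x w
      rw [map_mul, mul_apply_eq_comp, mul_apply_eq_comp, hw, map_zero, inner_zero_right] at h3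
      rw [sub_sub_cancel]
      exact h3
  show _ = x - (LinearMap.ker (Matrix.toEuclideanLin A)).starProjection x
  rw [h2, sub_sub_cancel]
  rfl

theorem self_mul_pinv {A : Matrix (Fin m) (Fin m) ℝ} (hA : A.IsSymm) :
    Matrix.toEuclideanCLM (𝕜 := ℝ) A * Matrix.toEuclideanCLM (𝕜 := ℝ) (pinv A) =
      1 - (LinearMap.ker (Matrix.toEuclideanLin A)).starProjection := by
  have h := (isMoorePenrose_pinv hA).2.2.1
  rw [Matrix.IsSymm, Matrix.transpose_mul, hA, pinv_isSymm hA] at h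
  rw [← pinv_mul_self hA, ← map_mul, ← map_mul, h]

theorem pinv_apply_of_mem_ker {A : Matrix (Fin m) (Fin m) ℝ} (hA : A.IsSymm)
    {x : EuclideanSpace ℝ (Fin m)} (hx : Matrix.toEuclideanCLM (𝕜 := ℝ) A x = 0) :
    Matrix.toEuclideanCLM (𝕜 := ℝ) (pinv A) x = 0 := by
  have h1 := congrArg (fun M => Matrix.toEuclideanCLM (𝕜 := ℝ) M x) (isMoorePenrose_pinv hA).2.1
  have h2 := self_mul_pinv hA
  rw [← pinv_mul_self hA] at h2
  have h3 := DFunLike.congr_fun h2 x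
  simp only [map_mul, mul_apply_eq_comp] at h1 h3
  rw [← h1, h3, hx, map_zero, map_zero]

end SymmetricMatrices

/-! ### The smooth frame of the lowest eigenspaces -/

section LowFrame

variable {m k : ℕ}

/-- The columns of `lowFrame`, as vectors depending on a symmetric matrix. -/
noncomputable def lowVectors (e : Fin k → EuclideanSpace ℝ (Fin m)) (B : SymMat m) :
    Fin k → EuclideanSpace ℝ (Fin m) :=
  InnerProductSpace.gramSchmidtNormed ℝ fun l => (lowEigenspace k B.toMatrix).starProjection (e l)

theorem orthonormal_coe_basis {V : Type*} [NormedAddCommGroup V] [InnerProductSpace ℝ V]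
    {K : Submodule ℝ V} (e : OrthonormalBasis (Fin k) ℝ K) :
    Orthonormal ℝ (fun i => (e i : V)) ∧ Submodule.span ℝ (range fun i => (e i : V)) = K := by
  refine ⟨e.orthonormal.comp_linearIsometry K.subtypeₗᵢ, ?_⟩
  have h1 : (range fun i => (e i : V)) = K.subtype '' range e := by
    rw [← range_comp]
    rfl
  have h2 : Submodule.span ℝ (range e) = ⊤ := by
    have := e.toBasis.span_eq
    rwa [e.coe_toBasis] at this
  rw [h1, ← Submodule.map_span, h2, Submodule.map_top, Submodule.range_subtype]

/-- Near a positive semidefinite matrix with kernel basis `f`, the columns `lowVectors f` form a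
smooth orthonormal basis of an invariant subspace, triangular with respect to `f`, and the
quadratic form is nonnegative on the orthogonal complement. -/
theorem lowVectors_properties {z : SymMat m} (hz : z ∈ psdCone m)
    {f : Fin k → EuclideanSpace ℝ (Fin m)} (hfo : Orthonormal ℝ f)
    (hspan : Submodule.span ℝ (range f) = LinearMap.ker (Matrix.toEuclideanLin z.toMatrix)) :
    (∀ i, ContDiffAt ℝ 2 (fun B => lowVectors f B i) z) ∧ lowVectors f z = f ∧
    ∀ᶠ B in 𝓝 z, Orthonormal ℝ (lowVectors f B) ∧
      (∀ j, SymMat.toCLM B (lowVectors f B j) =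
        ∑ l, ⟪lowVectors f B l, SymMat.toCLM B (lowVectors f B j)⟫_ℝ • lowVectors f B l) ∧
      (∀ i j, i < j → ⟪lowVectors f B j, f i⟫_ℝ = 0) ∧
      (∀ x, (∀ l, ⟪lowVectors f B l, x⟫_ℝ = 0) → 0 ≤ ⟪SymMat.toCLM B x, x⟫_ℝ) := by
  set K := LinearMap.ker (Matrix.toEuclideanLin z.toMatrix) with hK
  set Z := SymMat.toCLM z with hZ
  have hZpsd := (mem_psdCone_iff z).1 hz
  have hKZ : ∀ x, x ∈ K ↔ Z x = 0 := fun x => Iff.rfl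
  have hfK : ∀ i, f i ∈ K := fun i => hspan ▸ Submodule.subset_span (mem_range_self i)
  -- the smooth family of invariant subspaces
  obtain ⟨v, hv, hvZ, hvB⟩ := exists_smooth_invariant_frame (Z := Z) (P := K.starProjection)
    (Z' := Matrix.toEuclideanCLM (𝕜 := ℝ) (pinv z.toMatrix)) (k := k) (e := f)
    (by
      refine ContinuousLinearMap.ext fun x => ?_
      exact Submodule.starProjection_eq_self_iff.2 (K.starProjection_apply_mem x))
    (ContinuousLinearMap.ext fun x => (hKZ _).1 (K.starProjection_apply_mem x))
    (by
      refine ContinuousLinearMap.ext fun x => ?_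
      refine (K.starProjection_apply_eq_zero_iff).2 ((Submodule.mem_orthogonal _ _).2 fun y hy => ?_)
      have h1 : ⟪Z y, x⟫_ℝ = ⟪y, Z x⟫_ℝ := SymMat.toCLM_symmetric z y x
      show ⟪y, Z x⟫_ℝ = 0
      rw [← h1, (hKZ y).1 hy, inner_zero_left])
    (self_mul_pinv z.isSymm) (pinv_mul_self z.isSymm) hfo
    (fun i => Submodule.starProjection_eq_self_iff.2 (hfK i))
    (fun x => hspan ▸ K.starProjection_apply_mem x)
  have hker : ∀ x, ⟪Z x, x⟫_ℝ = 0 → x ∈ Submodule.span ℝ (range f) := fun x hx =>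
    hspan ▸ toCLM_eq_zero_of_mem_psdCone hz hx
  obtain ⟨c, hc, hcpos⟩ := exists_pos_lower_bound hZpsd hfo hker
  have hT : ContinuousAt (fun B : SymMat m => SymMat.toCLM B) z := SymMat.toCLM.continuous.continuousAt
  have hvs : ∀ i, ContDiffAt ℝ 2 (fun B : SymMat m => v (SymMat.toCLM B) i) z := fun i =>
    ContDiffAt.comp (g := fun T => v T i) z (hv i) SymMat.toCLM.contDiff.contDiffAt
  have hvz : v (SymMat.toCLM z) = f := hvZ
  have hsep := eventually_separated hT (v := fun B => v (SymMat.toCLM B))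
    (fun i => (hvs i).continuousAt) (fun i => by rw [hvz]; exact (hKZ _).1 (hfK i)) hc
    (fun x => by rw [hvz]; exact hcpos x)
  have hlow : ∀ᶠ B : SymMat m in 𝓝 z, Orthonormal ℝ (v (SymMat.toCLM B)) ∧
      lowEigenspace k B.toMatrix = Submodule.span ℝ (range (v (SymMat.toCLM B))) ∧
      (∀ x ∈ Submodule.span ℝ (range (v (SymMat.toCLM B))),
        SymMat.toCLM B x ∈ Submodule.span ℝ (range (v (SymMat.toCLM B)))) ∧
      ∀ x ∈ (Submodule.span ℝ (range (v (SymMat.toCLM B))))ᗮ, 0 ≤ ⟪SymMat.toCLM B x, x⟫_ℝ := by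
    filter_upwards [hT.eventually hvB, hsep] with B ⟨h1, h2⟩ h3
    obtain ⟨h4, h5⟩ := h3 h1
    refine ⟨h1, ?_, h2, fun x hx => le_trans (by positivity) (h5 x hx)⟩
    have hdim : Module.finrank ℝ (Submodule.span ℝ (range (v (SymMat.toCLM B)))) = k := by
      rw [finrank_span_eq_card h1.linearIndependent, Fintype.card_fin]
    have := iSup_lowest_eigenspaces_eq
      (T := (SymMat.toCLM B : EuclideanSpace ℝ (Fin m) →ₗ[ℝ] EuclideanSpace ℝ (Fin m)))
      (fun x y => SymMat.toCLM_symmetric B x y) h2 (by linarith : c / 4 < c / 2) h4 h5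
    rw [hdim] at this
    exact this
  -- the projections of the kernel basis
  set w : SymMat m → Fin k → EuclideanSpace ℝ (Fin m) := fun B l =>
    ∑ j, ⟪v (SymMat.toCLM B) j, f l⟫_ℝ • v (SymMat.toCLM B) j with hw
  have hwB : ∀ B : SymMat m, Orthonormal ℝ (v (SymMat.toCLM B)) → ∀ l, w B l =
      (Submodule.span ℝ (range (v (SymMat.toCLM B)))).starProjection (f l) := fun B h l =>
    (starProjection_span_range h (f l)).symm
  have hwu : ∀ᶠ B : SymMat m in 𝓝 z,
      lowVectors f B = InnerProductSpace.gramSchmidtNormed ℝ (w B) := by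
    filter_upwards [hlow] with B ⟨h1, h2, _⟩
    rw [funext (hwB B h1)]
    simp only [lowVectors, h2]
  have hwz : w z = f := by
    funext l
    rw [hwB z (hvz ▸ hfo), Submodule.starProjection_eq_self_iff, hvz]
    exact Submodule.subset_span (mem_range_self l)
  have hws : ∀ l, ContDiffAt ℝ 2 (fun B => w B l) z := fun l =>
    ContDiffAt.sum fun j _ => ((hvs j).inner ℝ contDiffAt_const).smul (hvs j)
  have hwli : ∀ᶠ B in 𝓝 z, LinearIndependent ℝ (w B) := by
    have hcont : ContinuousAt w z := continuousAt_pi.2 fun l => (hws l).continuousAt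
    have h0 : LinearIndependent ℝ (w z) := hwz ▸ hfo.linearIndependent
    exact hcont.eventually h0.eventually
  refine ⟨fun i => ?_, ?_, ?_⟩
  · refine (contDiffAt_gramSchmidtNormed hws (hwz ▸ hfo.linearIndependent) i).congr_of_eventuallyEq ?_
    filter_upwards [hwu] with B hB
    rw [hB]
  · rw [hwu.self_of_nhds, hwz, gramSchmidtNormed_of_orthonormal hfo]
  · filter_upwards [hwu, hwli, hlow] with B hB hli ⟨h1, _, h3, h4⟩
    set R := Submodule.span ℝ (range (v (SymMat.toCLM B))) with hR
    have hu : Orthonormal ℝ (lowVectors f B) := by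
      rw [hB]
      exact InnerProductSpace.gramSchmidtNormed_orthonormal hli
    have huR : Submodule.span ℝ (range (lowVectors f B)) = R := by
      refine Submodule.eq_of_le_of_finrank_eq ?_ ?_
      · rw [hB, InnerProductSpace.span_gramSchmidtNormed_range, InnerProductSpace.span_gramSchmidt,
          Submodule.span_le]
        rintro _ ⟨l, rfl⟩
        rw [hwB B h1]
        exact R.starProjection_apply_mem _
      · rw [finrank_span_eq_card hu.linearIndependent, hR, finrank_span_eq_card h1.linearIndependent]
    have huj : ∀ j, lowVectors f B j ∈ R := fun j => huR ▸ Submodule.subset_span (mem_range_self j)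
    refine ⟨hu, fun j => ?_, fun i j hij => ?_, fun x hx => h4 x ?_⟩
    · rw [← starProjection_span_range hu, huR, Submodule.starProjection_eq_self_iff.2 (h3 _ (huj j))]
    · have e1 : ⟪lowVectors f B j, f i⟫_ℝ = ⟪lowVectors f B j, w B i⟫_ℝ := by
        rw [hwB B h1, ← Submodule.inner_starProjection_left_eq_right,
          Submodule.starProjection_eq_self_iff.2 (huj j)]
      show ⟪lowVectors f B j, f i⟫_ℝ = 0
      rw [e1, hB, InnerProductSpace.gramSchmidtNormed, inner_smul_left,
        InnerProductSpace.gramSchmidt_inv_triangular ℝ _ hij, mul_zero]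
    · rw [← huR, Submodule.mem_orthogonal]
      intro y hy
      induction hy using Submodule.span_induction with
      | mem y hy =>
        obtain ⟨l, rfl⟩ := hy
        exact hx l
      | zero => exact inner_zero_left _
      | add a b _ _ ha hb => rw [inner_add_left, ha, hb, add_zero]
      | smul c a _ ha => rw [inner_smul_left, ha, mul_zero]

end LowFrame

/-! ### Reduction and curvature of the positive semidefinite cone -/

section PSDReduction

variable {m k : ℕ}

/-- The matrix with columns `f 1, …, f k`. -/
def frameMatrix (f : Fin k → EuclideanSpace ℝ (Fin m)) : Matrix (Fin m) (Fin k) ℝ :=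
  Matrix.of fun a j => f j a

theorem frameMatrix_conj_apply (f : Fin k → EuclideanSpace ℝ (Fin m))
    (A : Matrix (Fin m) (Fin m) ℝ) (i j : Fin k) :
    ((frameMatrix f).transpose * A * frameMatrix f) i j =
      ⟪f i, Matrix.toEuclideanCLM (𝕜 := ℝ) A (f j)⟫_ℝ := by
  rw [Matrix.inner_toEuclideanCLM, Matrix.mul_assoc]
  rfl

theorem frameMatrix_transpose_mul_self {f : Fin k → EuclideanSpace ℝ (Fin m)}
    (hf : Orthonormal ℝ f) : (frameMatrix f).transpose * frameMatrix f = 1 := by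
  ext i j
  have h1 := frameMatrix_conj_apply f 1 i j
  rw [Matrix.mul_one, map_one] at h1
  rw [h1, Matrix.one_apply]
  exact orthonormal_iff_ite.1 hf i j

/-- Conjugating a symmetric `k × k` matrix with a frame gives a symmetric `m × m` matrix. -/
def SymMat.conj (F : Matrix (Fin m) (Fin k) ℝ) (s : SymMat k) : SymMat m :=
  SymMat.ofMatrix (F * s.toMatrix * F.transpose) (by
    rw [Matrix.IsSymm, Matrix.transpose_mul, Matrix.transpose_mul, Matrix.transpose_transpose,
      s.isSymm, Matrix.mul_assoc])

theorem psdReduction_entry (f : Fin k → EuclideanSpace ℝ (Fin m)) (B : SymMat m) (i j : Fin k) :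
    (psdReduction f B).toMatrix i j = ⟪lowVectors f B i, SymMat.toCLM B (lowVectors f B j)⟫_ℝ :=
  frameMatrix_conj_apply (lowVectors f B) B.toMatrix i j

theorem trace_conj_mul (f : Fin k → EuclideanSpace ℝ (Fin m)) (s : SymMat k)
    (A : Matrix (Fin m) (Fin m) ℝ) :
    ((SymMat.conj (frameMatrix f) s).toMatrix * A).trace =
      ∑ i, ∑ j, s.toMatrix i j * ⟪f i, Matrix.toEuclideanCLM (𝕜 := ℝ) A (f j)⟫_ℝ := by
  have h1 : ((SymMat.conj (frameMatrix f) s).toMatrix * A).trace =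
      (s.toMatrix * ((frameMatrix f).transpose * A * frameMatrix f)).trace := by
    show (frameMatrix f * s.toMatrix * (frameMatrix f).transpose * A).trace = _
    rw [Matrix.mul_assoc, Matrix.mul_assoc, Matrix.trace_mul_comm]
    simp only [Matrix.mul_assoc]
  have h2 : ∀ G : Matrix (Fin k) (Fin k) ℝ,
      (s.toMatrix * G).trace = ∑ i, ∑ j, s.toMatrix i j * G i j := by
    intro G
    simp only [Matrix.trace, Matrix.diag, Matrix.mul_apply]
    rw [Finset.sum_comm]
    exact Finset.sum_congr rfl fun i _ => Finset.sum_congr rfl fun j _ => by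
      rw [s.isSymm.apply]
  rw [h1, h2]
  simp only [frameMatrix_conj_apply]

theorem inner_toCLM_psdReduction (f : Fin k → EuclideanSpace ℝ (Fin m)) (B : SymMat m)
    (c : EuclideanSpace ℝ (Fin k)) :
    ⟪SymMat.toCLM (psdReduction f B) c, c⟫_ℝ =
      ⟪SymMat.toCLM B (∑ i, c i • lowVectors f B i), ∑ i, c i • lowVectors f B i⟫_ℝ := by
  rw [SymMat.toCLM_symmetric, SymMat.toCLM_eq, Matrix.inner_toEuclideanCLM,
    SymMat.toCLM_symmetric, map_sum, sum_inner]
  simp only [dotProduct, Matrix.mulVec, psdReduction_entry, inner_sum, map_smul, inner_smul_left,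
    inner_smul_right, conj_trivial, Finset.mul_sum]
  refine Finset.sum_congr rfl fun i _ => Finset.sum_congr rfl fun j _ => ?_
  ring

variable {z : SymMat m} {f : Fin k → EuclideanSpace ℝ (Fin m)}

theorem toCLM_eq_zero_of_span_eq_ker
    (hspan : Submodule.span ℝ (range f) = LinearMap.ker (Matrix.toEuclideanLin z.toMatrix))
    (i : Fin k) : SymMat.toCLM z (f i) = 0 := by
  have : f i ∈ LinearMap.ker (Matrix.toEuclideanLin z.toMatrix) :=
    hspan ▸ Submodule.subset_span (mem_range_self i)
  exact this

theorem SymMat.ext_entries {A B : SymMat m} (h : ∀ i j, A.toMatrix i j = B.toMatrix i j) : A = B := by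
  refine Subtype.ext ?_
  ext p
  exact h p.1 p.2

/-- Near `z` positive semidefiniteness is decided by the compression to the low eigenspace. -/
theorem eventually_mem_psdCone_iff (hz : z ∈ psdCone m) (hfo : Orthonormal ℝ f)
    (hspan : Submodule.span ℝ (range f) = LinearMap.ker (Matrix.toEuclideanLin z.toMatrix)) :
    ∀ᶠ B in 𝓝 z, B ∈ psdCone m ↔ psdReduction f B ∈ psdCone k := by
  filter_upwards [(lowVectors_properties hz hfo hspan).2.2] with B ⟨hu, hinv, _, hperp⟩
  rw [mem_psdCone_iff, mem_psdCone_iff]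
  constructor
  · intro h c
    rw [inner_toCLM_psdReduction]
    exact h _
  · intro h x
    set p := ∑ i, ⟪lowVectors f B i, x⟫_ℝ • lowVectors f B i with hp
    have h1 : 0 ≤ ⟪SymMat.toCLM B p, p⟫_ℝ := by
      have := h (WithLp.toLp 2 fun i => ⟪lowVectors f B i, x⟫_ℝ)
      rwa [inner_toCLM_psdReduction] at this
    have hlx : ∀ l, ⟪lowVectors f B l, x - p⟫_ℝ = 0 := by
      intro l
      rw [inner_sub_right, hp, hu.inner_right_fintype, sub_self]
    have h2 := hperp (x - p) hlx
    have h3 : ⟪SymMat.toCLM B p, x - p⟫_ℝ = 0 := by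
      rw [hp, map_sum, sum_inner]
      refine Finset.sum_eq_zero fun i _ => ?_
      rw [map_smul, inner_smul_left, hinv i, sum_inner]
      refine mul_eq_zero_of_right _ (Finset.sum_eq_zero fun l _ => ?_)
      rw [inner_smul_left, hlx, mul_zero]
    have h4 : ⟪SymMat.toCLM B (x - p), p⟫_ℝ = 0 := by
      rw [SymMat.toCLM_symmetric, real_inner_comm, h3]
    have h5 : x = p + (x - p) := by abel
    rw [h5, map_add, inner_add_left, inner_add_right, inner_add_right, h3, h4]
    linarith

theorem contDiffAt_psdReduction {B : SymMat m}
    (hu : ∀ i, ContDiffAt ℝ 2 (fun B => lowVectors f B i) B) : ContDiffAt ℝ 2 (psdReduction f) B := by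
  refine contDiffAt_symMat fun i j => ?_
  simp only [psdReduction_entry]
  exact (hu i).inner ℝ (SymMat.toCLM.contDiff.contDiffAt.clm_apply (hu j))

/-- The product rule for `U(B)^* B U(B)`. -/
theorem fderiv_psdReduction_entry {B : SymMat m}
    (hu : ∀ i, ContDiffAt ℝ 2 (fun B => lowVectors f B i) B) (w : SymMat m) (i j : Fin k) :
    (fderiv ℝ (psdReduction f) B w).toMatrix i j =
      ⟪fderiv ℝ (fun B => lowVectors f B i) B w, SymMat.toCLM B (lowVectors f B j)⟫_ℝ +
      ⟪lowVectors f B i, SymMat.toCLM w (lowVectors f B j)⟫_ℝ +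
      ⟪lowVectors f B i, SymMat.toCLM B (fderiv ℝ (fun B => lowVectors f B j) B w)⟫_ℝ := by
  have hd : ∀ i, DifferentiableAt ℝ (fun B => lowVectors f B i) B := fun i =>
    (hu i).differentiableAt (by norm_num)
  have hh := ((contDiffAt_psdReduction hu).differentiableAt (by norm_num)).hasFDerivAt
  have h1 := ((SymMat.entry i j).hasFDerivAt.comp B hh).fderiv
  have h2 : (SymMat.entry i j) ∘ psdReduction f =
      fun B => ⟪lowVectors f B i, SymMat.toCLM B (lowVectors f B j)⟫_ℝ := by
    funext B
    exact psdReduction_entry f B i j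
  have h3 : (fderiv ℝ (psdReduction f) B w).toMatrix i j =
      fderiv ℝ (SymMat.entry i j ∘ psdReduction f) B w := by
    rw [h1]
    rfl
  have hT : DifferentiableAt ℝ (fun B : SymMat m => SymMat.toCLM B) B :=
    SymMat.toCLM.differentiableAt
  rw [h3, h2, fderiv_inner_apply ℝ (hd i) (hT.clm_apply (hd j)), fderiv_clm_apply hT (hd j),
    ContinuousLinearMap.fderiv]
  simp only [add_apply, ContinuousLinearMap.comp_apply, ContinuousLinearMap.flip_apply,
    inner_add_right]
  ring

/-- At the base point only the middle term of the product rule survives. -/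
theorem fderiv_psdReduction_base (hz : z ∈ psdCone m) (hfo : Orthonormal ℝ f)
    (hspan : Submodule.span ℝ (range f) = LinearMap.ker (Matrix.toEuclideanLin z.toMatrix))
    (w : SymMat m) (i j : Fin k) :
    (fderiv ℝ (psdReduction f) z w).toMatrix i j = ⟪f i, SymMat.toCLM w (f j)⟫_ℝ := by
  obtain ⟨hu, huz, -⟩ := lowVectors_properties hz hfo hspan
  have hfz := toCLM_eq_zero_of_span_eq_ker hspan
  rw [fderiv_psdReduction_entry hu, huz, ← SymMat.toCLM_symmetric z (f i), hfz, hfz,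
    inner_zero_left, inner_zero_right, zero_add, add_zero]

theorem isConeReduction_psdReduction (hz : z ∈ psdCone m) (hfo : Orthonormal ℝ f)
    (hspan : Submodule.span ℝ (range f) = LinearMap.ker (Matrix.toEuclideanLin z.toMatrix)) :
    IsConeReduction (psdCone m) z (psdCone k) (psdReduction f) where
  isClosed := isClosedConvexCone_psdCone.isClosed
  mem := hz
  cone := isClosedConvexCone_psdCone
  reduces := exists_reduction_nhds (contDiffAt_psdReduction (lowVectors_properties hz hfo hspan).1)
    (eventually_mem_psdCone_iff hz hfo hspan)
  map_eq_zero := by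
    obtain ⟨-, huz, -⟩ := lowVectors_properties hz hfo hspan
    refine SymMat.ext_entries fun i j => ?_
    rw [psdReduction_entry, huz, toCLM_eq_zero_of_span_eq_ker hspan, inner_zero_right]
    rfl
  surjective := by
    intro s
    refine ⟨SymMat.conj (frameMatrix f) s, SymMat.ext_entries fun i j => ?_⟩
    rw [fderiv_psdReduction_base hz hfo hspan, SymMat.toCLM_eq, ← frameMatrix_conj_apply]
    have hF := frameMatrix_transpose_mul_self hfo
    have : (frameMatrix f).transpose *
        (frameMatrix f * s.toMatrix * (frameMatrix f).transpose) * frameMatrix f =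
        ((frameMatrix f).transpose * frameMatrix f) * s.toMatrix *
          ((frameMatrix f).transpose * frameMatrix f) := by simp only [Matrix.mul_assoc]
    rw [SymMat.conj, SymMat.toMatrix_ofMatrix, this, hF, Matrix.one_mul, Matrix.mul_one]

/-- The derivative of `U(B)` at the base point is orthogonal to the kernel: since `U(B)` is
orthonormal, `U(z)^* U'(z) w` is antisymmetric, and since `U(B)` is triangular with respect to
`f = U(z)`, it is triangular. -/
theorem inner_fderiv_lowVectors_eq_zero (hz : z ∈ psdCone m) (hfo : Orthonormal ℝ f)
    (hspan : Submodule.span ℝ (range f) = LinearMap.ker (Matrix.toEuclideanLin z.toMatrix))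
    (w : SymMat m) (i j : Fin k) :
    ⟪f i, fderiv ℝ (fun B => lowVectors f B j) z w⟫_ℝ = 0 := by
  obtain ⟨hu, huz, hnear⟩ := lowVectors_properties hz hfo hspan
  have hd : ∀ i, DifferentiableAt ℝ (fun B => lowVectors f B i) z := fun i =>
    (hu i).differentiableAt (by norm_num)
  have hanti : ∀ i j, ⟪f i, fderiv ℝ (fun B => lowVectors f B j) z w⟫_ℝ +
      ⟪fderiv ℝ (fun B => lowVectors f B i) z w, f j⟫_ℝ = 0 := by
    intro i j
    have h1 : (fun B => ⟪lowVectors f B i, lowVectors f B j⟫_ℝ) =ᶠ[𝓝 z]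
        fun _ => if i = j then 1 else 0 := by
      filter_upwards [hnear] with B hB
      exact orthonormal_iff_ite.1 hB.1 i j
    have h2 := fderiv_inner_apply ℝ (hd i) (hd j) w
    rw [h1.fderiv_eq, huz] at h2
    simpa using h2.symm
  have htri : ∀ i j, i < j → ⟪f i, fderiv ℝ (fun B => lowVectors f B j) z w⟫_ℝ = 0 := by
    intro i j hij
    have h1 : (fun B => ⟪lowVectors f B j, f i⟫_ℝ) =ᶠ[𝓝 z] fun _ => 0 := by
      filter_upwards [hnear] with B hB
      exact hB.2.2.1 i j hij
    have h2 := fderiv_inner_apply ℝ (hd j) (differentiableAt_const (f i)) w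
    rw [h1.fderiv_eq] at h2
    rw [real_inner_comm]
    simpa using h2.symm
  rcases lt_trichotomy i j with h | h | h
  · exact htri i j h
  · subst h
    have := hanti i i
    rw [real_inner_comm (f i)] at this
    linarith
  · have h1 := hanti i j
    rw [real_inner_comm (f j), htri j i h, add_zero] at h1
    exact h1

/-- The derivative of the low eigenvectors: `U'(z) w = -z† w U(z)`. -/
theorem fderiv_lowVectors (hz : z ∈ psdCone m) (hfo : Orthonormal ℝ f)
    (hspan : Submodule.span ℝ (range f) = LinearMap.ker (Matrix.toEuclideanLin z.toMatrix))
    (w : SymMat m) (j : Fin k) :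
    fderiv ℝ (fun B => lowVectors f B j) z w =
      -Matrix.toEuclideanCLM (𝕜 := ℝ) (pinv z.toMatrix) (SymMat.toCLM w (f j)) := by
  obtain ⟨hu, huz, hnear⟩ := lowVectors_properties hz hfo hspan
  have hfz := toCLM_eq_zero_of_span_eq_ker hspan
  have hd : ∀ i, DifferentiableAt ℝ (fun B => lowVectors f B i) z := fun i =>
    (hu i).differentiableAt (by norm_num)
  have hT : DifferentiableAt ℝ (fun B : SymMat m => SymMat.toCLM B) z :=
    SymMat.toCLM.differentiableAt
  set D := fderiv ℝ (fun B => lowVectors f B j) z w with hD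
  -- differentiate `B u_j = ∑ h_lj u_l`; the coefficients vanish at the base point
  obtain ⟨c, hc⟩ : ∃ c : Fin k → ℝ,
      SymMat.toCLM z D + SymMat.toCLM w (f j) = ∑ l, c l • f l := by
    have hH : ∀ l, DifferentiableAt ℝ
        (fun B => ⟪lowVectors f B l, SymMat.toCLM B (lowVectors f B j)⟫_ℝ) z := fun l =>
      (hd l).inner ℝ (hT.clm_apply (hd j))
    have h1 : (fun B => SymMat.toCLM B (lowVectors f B j)) =ᶠ[𝓝 z]
        fun B => ∑ l, ⟪lowVectors f B l, SymMat.toCLM B (lowVectors f B j)⟫_ℝ • lowVectors f B l := by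
      filter_upwards [hnear] with B hB
      exact hB.2.1 j
    have h2 := h1.fderiv_eq (𝕜 := ℝ)
    have hsm : ∀ l ∈ Finset.univ, DifferentiableAt ℝ (fun B =>
        ⟪lowVectors f B l, SymMat.toCLM B (lowVectors f B j)⟫_ℝ • lowVectors f B l) z :=
      fun l _ => (hH l).smul (hd l)
    rw [fderiv_clm_apply hT (hd j), ContinuousLinearMap.fderiv, fderiv_fun_sum hsm] at h2
    have h3 := DFunLike.congr_fun h2 w
    refine ⟨fun l => fderiv ℝ
      (fun B => ⟪lowVectors f B l, SymMat.toCLM B (lowVectors f B j)⟫_ℝ) z w, ?_⟩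
    rw [sum_apply] at h3
    simp only [add_apply, ContinuousLinearMap.comp_apply, ContinuousLinearMap.flip_apply, huz] at h3
    rw [h3]
    refine Finset.sum_congr rfl fun l _ => ?_
    rw [fderiv_fun_smul (hH l) (hd l)]
    simp [huz, hfz]
  have h4 := congrArg (Matrix.toEuclideanCLM (𝕜 := ℝ) (pinv z.toMatrix)) hc
  have h5 : ∀ l, Matrix.toEuclideanCLM (𝕜 := ℝ) (pinv z.toMatrix) (f l) = 0 := fun l =>
    pinv_apply_of_mem_ker z.isSymm (hfz l)
  have h6 : Matrix.toEuclideanCLM (𝕜 := ℝ) (pinv z.toMatrix) (SymMat.toCLM z D) = D := by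
    have := DFunLike.congr_fun (pinv_mul_self z.isSymm) D
    have h7 : (LinearMap.ker (Matrix.toEuclideanLin z.toMatrix)).starProjection D = 0 := by
      simp only [← hspan]
      rw [starProjection_span_range hfo]
      exact Finset.sum_eq_zero fun i _ => by
        rw [hD, inner_fderiv_lowVectors_eq_zero hz hfo hspan, zero_smul]
    have h8 : (1 - (LinearMap.ker (Matrix.toEuclideanLin z.toMatrix)).starProjection) D = D := by
      show D - (LinearMap.ker (Matrix.toEuclideanLin z.toMatrix)).starProjection D = D
      rw [h7, sub_zero]
    exact this.trans h8
  rw [map_add, h6, map_sum] at h4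
  simp only [map_smul, h5, smul_zero, Finset.sum_const_zero] at h4
  exact eq_neg_of_add_eq_zero_left h4

/-- The multiplier equation `l = ∇h(z)^* μ` reads `l = F μ F^*`. -/
theorem eq_conj_of_multiplier (hz : z ∈ psdCone m) (hfo : Orthonormal ℝ f)
    (hspan : Submodule.span ℝ (range f) = LinearMap.ker (Matrix.toEuclideanLin z.toMatrix))
    {l : SymMat m} {μ : SymMat k}
    (hμ : IsReducedMultiplier (psdCone k) (psdReduction f) z l μ) :
    l = SymMat.conj (frameMatrix f) μ := by
  refine ext_inner_right ℝ fun w => ?_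
  rw [hμ.1, LinearMap.adjoint_inner_left, SymMat.inner_eq_trace (SymMat.conj _ _), trace_conj_mul,
    SymMat.inner_eq_sum]
  refine Finset.sum_congr rfl fun i _ => Finset.sum_congr rfl fun j _ => ?_
  exact congrArg _ (fderiv_psdReduction_base hz hfo hspan w i j)

/-- The curvature of the reduction map in weak form. Since `B U = U h(B)`, the derivative of `h`
in direction `w` is `U^* w U` plus products of entries of `h` and of `U^* U' w`, both of which vanish
at the base point. -/
theorem inner_curvature_psdReduction (hz : z ∈ psdCone m) (hfo : Orthonormal ℝ f)
    (hspan : Submodule.span ℝ (range f) = LinearMap.ker (Matrix.toEuclideanLin z.toMatrix))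
    (μ : SymMat k) (u w : SymMat m) :
    ⟪w, curvature (psdReduction f) μ z u⟫_ℝ = ∑ i, ∑ j, μ.toMatrix i j *
      (⟪fderiv ℝ (fun B => lowVectors f B i) z u, SymMat.toCLM w (f j)⟫_ℝ +
        ⟪f i, SymMat.toCLM w (fderiv ℝ (fun B => lowVectors f B j) z u)⟫_ℝ) := by
  obtain ⟨hu, huz, hnear⟩ := lowVectors_properties hz hfo hspan
  have hfz := toCLM_eq_zero_of_span_eq_ker hspan
  have hd : ∀ i, DifferentiableAt ℝ (fun B => lowVectors f B i) z := fun i =>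
    (hu i).differentiableAt (by norm_num)
  have hT : DifferentiableAt ℝ (fun B : SymMat m => SymMat.toCLM B) z :=
    SymMat.toCLM.differentiableAt
  set H : Fin k → Fin k → SymMat m → ℝ := fun l j B =>
    ⟪lowVectors f B l, SymMat.toCLM B (lowVectors f B j)⟫_ℝ with hH_def
  set a : Fin k → Fin k → SymMat m → ℝ := fun l i B =>
    ⟪lowVectors f B l, fderiv ℝ (fun B => lowVectors f B i) B w⟫_ℝ with ha_def
  have hH : ∀ l j, DifferentiableAt ℝ (H l j) z := fun l j => (hd l).inner ℝ (hT.clm_apply (hd j))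
  have ha : ∀ l i, DifferentiableAt ℝ (a l i) z := fun l i => by
    have h1 : DifferentiableAt ℝ (fderiv ℝ (fun B => lowVectors f B i)) z :=
      ((hu i).fderiv_right (m := 1) (by norm_num)).differentiableAt (by norm_num)
    exact (hd l).inner ℝ (h1.clm_apply (differentiableAt_const w))
  have hHz : ∀ l j, H l j z = 0 := fun l j => by
    simp only [hH_def, huz, hfz, inner_zero_right]
  have haz : ∀ l i, a l i z = 0 := fun l i => by
    simp only [ha_def, huz]
    exact inner_fderiv_lowVectors_eq_zero hz hfo hspan w l i
  have hprod : ∀ l i l' j, HasFDerivAt (fun B => H l i B * a l' j B) (0 : SymMat m →L[ℝ] ℝ) z := by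
    intro l i l' j
    have := (hH l i).hasFDerivAt.mul (ha l' j).hasFDerivAt
    rw [hHz, haz, zero_smul, zero_smul, add_zero] at this
    exact this
  have hmid : ∀ i j, HasFDerivAt (fun B => ⟪lowVectors f B i, SymMat.toCLM w (lowVectors f B j)⟫_ℝ)
      (fderiv ℝ (fun B => ⟪lowVectors f B i, SymMat.toCLM w (lowVectors f B j)⟫_ℝ) z) z := fun i j =>
    ((hd i).inner ℝ ((SymMat.toCLM w).differentiableAt.comp z (hd j))).hasFDerivAt
  have hψ : HasFDerivAt (fun B => ∑ i, ∑ j, μ.toMatrix i j *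
      (∑ l, (H l j B * a l i B + H l i B * a l j B) +
        ⟪lowVectors f B i, SymMat.toCLM w (lowVectors f B j)⟫_ℝ))
      (∑ i, ∑ j, μ.toMatrix i j • ((∑ _l : Fin k, (0 + 0)) +
        fderiv ℝ (fun B => ⟪lowVectors f B i, SymMat.toCLM w (lowVectors f B j)⟫_ℝ) z)) z :=
    HasFDerivAt.fun_sum fun i _ => HasFDerivAt.fun_sum fun j _ =>
      (((HasFDerivAt.fun_sum fun l _ => (hprod l j l i).add (hprod l i l j)).add
        (hmid i j)).const_mul (μ.toMatrix i j))
  have heq : (fun B => ⟪μ, fderiv ℝ (psdReduction f) B w⟫_ℝ) =ᶠ[𝓝 z] fun B => ∑ i, ∑ j,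
      μ.toMatrix i j * (∑ l, (H l j B * a l i B + H l i B * a l j B) +
        ⟪lowVectors f B i, SymMat.toCLM w (lowVectors f B j)⟫_ℝ) := by
    have hu' : ∀ᶠ B in 𝓝 z, ∀ i, ContDiffAt ℝ 2 (fun B => lowVectors f B i) B :=
      eventually_all.2 fun i => (hu i).eventually (by simp)
    filter_upwards [hu', hnear] with B hB ⟨_, hinv, _⟩
    rw [SymMat.inner_eq_sum]
    refine Finset.sum_congr rfl fun i _ => Finset.sum_congr rfl fun j _ => ?_
    rw [fderiv_psdReduction_entry hB, ← SymMat.toCLM_symmetric B (lowVectors f B i), hinv i, hinv j,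
      inner_sum, sum_inner, Finset.sum_add_distrib]
    have e1 : ∀ l, ⟪fderiv ℝ (fun B => lowVectors f B i) B w,
        ⟪lowVectors f B l, SymMat.toCLM B (lowVectors f B j)⟫_ℝ • lowVectors f B l⟫_ℝ =
        H l j B * a l i B := fun l => by
      rw [inner_smul_right, real_inner_comm (lowVectors f B l)]
    have e2 : ∀ l, ⟪⟪lowVectors f B l, SymMat.toCLM B (lowVectors f B i)⟫_ℝ • lowVectors f B l,
        fderiv ℝ (fun B => lowVectors f B j) B w⟫_ℝ = H l i B * a l j B := fun l => by
      rw [inner_smul_left, conj_trivial]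
    simp only [e1, e2]
    ring
  have h1 := hasFDerivAt_inner_fderiv (contDiffAt_psdReduction hu) μ w
  have h2 := DFunLike.congr_fun (h1.unique (hψ.congr_of_eventuallyEq heq)) u
  have h3 : ⟪w, curvature (psdReduction f) μ z u⟫_ℝ = _ := h2
  rw [h3, sum_apply]
  refine Finset.sum_congr rfl fun i _ => ?_
  rw [sum_apply]
  refine Finset.sum_congr rfl fun j _ => ?_
  have h4 : fderiv ℝ (fun B => SymMat.toCLM w (lowVectors f B j)) z u =
      SymMat.toCLM w (fderiv ℝ (fun B => lowVectors f B j) z u) := by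
    have := ((SymMat.toCLM w).hasFDerivAt.comp z (hd j).hasFDerivAt).fderiv
    exact DFunLike.congr_fun this u
  have hw' : DifferentiableAt ℝ (fun B => SymMat.toCLM w (lowVectors f B j)) z :=
    (SymMat.toCLM w).differentiableAt.comp z (hd j)
  rw [smul_apply, add_apply, smul_eq_mul, fderiv_inner_apply ℝ (hd i) hw', huz]
  simp only [add_zero, Finset.sum_const_zero, zero_apply, zero_add]
  rw [← h4, add_comm]

/-- The curvature term of the positive semidefinite cone. The two expressions agree in weak form
because the trace is cyclic and invariant under transposition. -/
theorem curvature_psdReduction (hz : z ∈ psdCone m) (hfo : Orthonormal ℝ f)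
    (hspan : Submodule.span ℝ (range f) = LinearMap.ker (Matrix.toEuclideanLin z.toMatrix))
    {l : SymMat m} {μ : SymMat k}
    (hμ : IsReducedMultiplier (psdCone k) (psdReduction f) z l μ) (u : SymMat m) :
    (curvature (psdReduction f) μ z u).toMatrix =
        -(l.toMatrix * u.toMatrix * pinv z.toMatrix + pinv z.toMatrix * u.toMatrix * l.toMatrix) ∧
      ∀ w : SymMat m, ⟪curvature (psdReduction f) μ z u, w⟫_ℝ =
        (((-2 : ℝ) • (l.toMatrix * u.toMatrix * pinv z.toMatrix)) * w.toMatrix).trace := by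
  have hl := eq_conj_of_multiplier hz hfo hspan hμ
  have hd := pinv_isSymm z.isSymm
  set d := pinv z.toMatrix with hd_def
  have hweak : ∀ w : SymMat m, ⟪curvature (psdReduction f) μ z u, w⟫_ℝ =
      -((l.toMatrix * (u.toMatrix * d * w.toMatrix)).trace +
        (l.toMatrix * (w.toMatrix * d * u.toMatrix)).trace) := by
    intro w
    rw [real_inner_comm, inner_curvature_psdReduction hz hfo hspan, hl, trace_conj_mul,
      trace_conj_mul, ← Finset.sum_add_distrib, ← Finset.sum_neg_distrib]
    refine Finset.sum_congr rfl fun i _ => ?_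
    rw [← Finset.sum_add_distrib, ← Finset.sum_neg_distrib]
    refine Finset.sum_congr rfl fun j _ => ?_
    rw [fderiv_lowVectors hz hfo hspan, fderiv_lowVectors hz hfo hspan, ← hd_def, inner_neg_left,
      map_neg, inner_neg_right, inner_toEuclideanCLM_comm hd, SymMat.toCLM_symmetric]
    simp only [map_mul, mul_apply_eq_comp, SymMat.toCLM_eq]
    ring
  have hcyc : ∀ w : SymMat m, (l.toMatrix * (w.toMatrix * d * u.toMatrix)).trace =
      (d * u.toMatrix * l.toMatrix * w.toMatrix).trace := by
    intro w
    rw [← Matrix.mul_assoc, ← Matrix.mul_assoc, Matrix.mul_assoc (l.toMatrix * w.toMatrix),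
      Matrix.trace_mul_comm, ← Matrix.mul_assoc]
  have htr : ∀ w : SymMat m, (d * u.toMatrix * l.toMatrix * w.toMatrix).trace =
      (l.toMatrix * (u.toMatrix * d * w.toMatrix)).trace := by
    intro w
    rw [← Matrix.trace_transpose]
    simp only [Matrix.transpose_mul, u.isSymm.eq, l.isSymm.eq, w.isSymm.eq, hd.eq]
    rw [Matrix.trace_mul_comm]
    simp only [Matrix.mul_assoc]
  refine ⟨?_, fun w => ?_⟩
  · have hS : (-(l.toMatrix * u.toMatrix * d + d * u.toMatrix * l.toMatrix)).IsSymm := by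
      rw [Matrix.IsSymm, Matrix.transpose_neg, Matrix.transpose_add]
      simp only [Matrix.transpose_mul, u.isSymm.eq, l.isSymm.eq, hd.eq]
      rw [add_comm]
      simp only [Matrix.mul_assoc]
    have h1 : curvature (psdReduction f) μ z u = SymMat.ofMatrix _ hS := by
      refine ext_inner_right ℝ fun w => ?_
      rw [hweak, hcyc, SymMat.inner_eq_trace, SymMat.toMatrix_ofMatrix, Matrix.neg_mul,
        Matrix.trace_neg, Matrix.add_mul, Matrix.trace_add]
      simp only [Matrix.mul_assoc]
    rw [h1, SymMat.toMatrix_ofMatrix]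
  · rw [hweak, hcyc, htr, Matrix.smul_mul, Matrix.trace_smul]
    simp only [Matrix.mul_assoc, smul_eq_mul]
    ring

end PSDReduction

end VarAnal

theorem proposition3p7 :
    -- the general formula
    (∀ (Y : Type*) [NormedAddCommGroup Y] [InnerProductSpace ℝ Y] [FiniteDimensional ℝ Y]
        (E : Type*) [NormedAddCommGroup E] [InnerProductSpace ℝ E] [FiniteDimensional ℝ E]
        (Θ : Set Y) (C : Set E) (h : Y → E) (z l : Y),
        l ∈ normalCone Θ z → IsConeReduction Θ z C h →
        (∃! μ : E, IsReducedMultiplier C h z l μ) ∧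
        ∀ μ : E, IsReducedMultiplier C h z l μ → ∀ u : Y,
          graphicalDerivative (normalCone Θ) z l u =
            (fun w => curvature h μ z u + w) '' normalCone (criticalCone Θ z l) u) ∧
    -- convex polyhedra
    (∀ (m s t : ℕ) (Θ : Set (EuclideanSpace ℝ (Fin m))) (z : EuclideanSpace ℝ (Fin m))
        (A : WithLp 2 (EuclideanSpace ℝ (Fin s) × EuclideanSpace ℝ (Fin t)) ≃ₗᵢ[ℝ]
          EuclideanSpace ℝ (Fin m)),
        IsConvexPolyhedron Θ → z ∈ Θ →
        (∀ y, y ∈ Submodule.span ℝ (normalCone Θ z) ↔ (A.symm y).snd = 0) →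
        IsConeReduction Θ z (polyCone Θ A z) (polyReduction A z) ∧
        ∀ l ∈ normalCone Θ z, ∀ μ,
          IsReducedMultiplier (polyCone Θ A z) (polyReduction A z) z l μ →
          ∀ u, curvature (polyReduction A z) μ z u = 0) ∧
    -- the second-order cone
    (∀ (n : ℕ) (z : LorentzSpace n), z ∈ secondOrderCone n →
        (z = 0 →
          IsConeReduction (secondOrderCone n) z (secondOrderCone n) id ∧
          ∀ l ∈ normalCone (secondOrderCone n) z, ∀ μ,
            IsReducedMultiplier (secondOrderCone n) id z l μ →
            ∀ u, curvature id μ z u = socCurvature z l u) ∧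
        (z ∈ interior (secondOrderCone n) →
          IsConeReduction (secondOrderCone n) z {0}
            (fun _ : LorentzSpace n => (0 : EuclideanSpace ℝ (Fin 0))) ∧
          ∀ l ∈ normalCone (secondOrderCone n) z, ∀ μ,
            IsReducedMultiplier {0}
              (fun _ : LorentzSpace n => (0 : EuclideanSpace ℝ (Fin 0))) z l μ →
            ∀ u, curvature (fun _ : LorentzSpace n => (0 : EuclideanSpace ℝ (Fin 0))) μ z u =
              socCurvature z l u) ∧
        (z ∈ frontier (secondOrderCone n) → z ≠ 0 →
          IsConeReduction (secondOrderCone n) z (Set.Iic (0 : ℝ)) socReduction ∧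
          ∀ l ∈ normalCone (secondOrderCone n) z, ∀ μ,
            IsReducedMultiplier (Set.Iic (0 : ℝ)) socReduction z l μ →
            ∀ u, curvature socReduction μ z u = socCurvature z l u)) ∧
    -- the positive semidefinite cone
    (∀ (m k : ℕ) (z : SymMat m), z ∈ psdCone m →
        ∀ e : OrthonormalBasis (Fin k) ℝ (LinearMap.ker (Matrix.toEuclideanLin z.toMatrix)),
        IsConeReduction (psdCone m) z (psdCone k)
          (psdReduction fun i => (e i : EuclideanSpace ℝ (Fin m))) ∧
        ∀ l ∈ normalCone (psdCone m) z, ∀ μ,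
          IsReducedMultiplier (psdCone k)
            (psdReduction fun i => (e i : EuclideanSpace ℝ (Fin m))) z l μ →
          ∀ u : SymMat m,
            (curvature (psdReduction fun i => (e i : EuclideanSpace ℝ (Fin m))) μ z u).toMatrix =
                -(l.toMatrix * u.toMatrix * pinv z.toMatrix +
                  pinv z.toMatrix * u.toMatrix * l.toMatrix) ∧
            ∀ w : SymMat m,
              inner ℝ (curvature (psdReduction fun i => (e i : EuclideanSpace ℝ (Fin m))) μ z u) w =
                (((-2 : ℝ) • (l.toMatrix * u.toMatrix * pinv z.toMatrix)) * w.toMatrix).trace) := by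
  refine ⟨?_, ?_, ?_, ?_⟩
  · intro Y _ _ _ E _ _ _ Θ C h z l hl hred
    exact ⟨hred.existsUnique_multiplier hl, fun μ hμ u =>
      hred.graphicalDerivative_normalCone hl hμ u⟩
  · intro m s t Θ z A hΘ hz hA
    exact ⟨isConeReduction_polyReduction hΘ hz hA, fun l _ μ _ u =>
      curvature_eq_zero_of_affine (hasFDerivAt_polyReduction A z) μ z u⟩
  · intro n z hz
    refine ⟨?_, fun hi => ⟨isConeReduction_zero_of_mem_interior hi, fun l _ μ _ u => ?_⟩,
      fun hb hz0 => ⟨isConeReduction_socReduction hb hz0, fun l _ μ hμ u =>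
        curvature_socReduction hb hz0 hμ u⟩⟩
    · rintro rfl
      refine ⟨isConeReduction_id_secondOrderCone, fun l _ μ _ u => ?_⟩
      rw [socCurvature_zero]
      exact curvature_eq_zero_of_affine (fun y => hasFDerivAt_id y) μ 0 u
    · rw [socCurvature_of_mem_interior hi]
      exact curvature_eq_zero_of_affine (fun y => hasFDerivAt_const _ y) μ z u
  · intro m k z hz e
    obtain ⟨hfo, hspan⟩ := orthonormal_coe_basis e
    exact ⟨isConeReduction_psdReduction hz hfo hspan, fun l _ μ hμ u =>
      curvature_psdReduction hz hfo hspan hμ u⟩
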